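/- **Setting.** Let $I=[a,b]$ and let $\mathbf c$ be a smooth unit speed embedded curve in $\mathbb R^3$, defined near $I$, with curvature $\kappa>0$, Frenet frame $\mathbf e,\mathbf n,\mathbf b$ and torsion $\tau=\mathbf n'\cdot\mathbf b$. For a smooth function $\alpha$ with $0<|\alpha|<\pi/2$ let $f^{\alpha}$ be the developable strip along $\mathbf c$ with first angular function $\alpha$, $$f^{\alpha}(t,v)=\mathbf c(t)+v\bigl(\cos\beta\,\mathbf e+\sin\beta(\cos\alpha\,\mathbf n+\sin\alpha\,\mathbf b)\bigr)(t),\qquad \cot\beta=\frac{\alpha'+\tau}{\kappa\sin\alpha},\quad 0<\beta<\pi ,$$ and let $\phi_{f^\alpha}(t,v)$ be $f^{\alpha}(t,v)$ for $v\ge 0$ and $f^{-\alpha}(t,v)$ for $v<0$. The strip $\check f=f^{-\alpha}$ is the *dual* of $f=f^\alpha$. Suppose $0<\alpha<\pi/2$, put $\mu=\kappa\cos\alpha$, and assume $\max_I\mu<\min_I\kappa$. The *inverse* $f_*$ of $f$ is the developable strip along the reversed curve $\mathbf c^\sharp(t)=\mathbf c(a+b-t)$, with curvature $\kappa^\sharp$,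 whose first angular function is the function $\alpha_*:I\to(0,\pi/2)$ with $\kappa^\sharp\cos\alpha_*=\mu$; the *inverse dual* $\check f_*$ is the dual of $f_*$. For $\delta>0$ let $P_1(\delta),P_2(\delta),P_3(\delta),P_4(\delta)$ be the images of $I\times(-\delta,\delta)$ under $\phi_f,\phi_{\check f},\phi_{f_*},\phi_{\check f_*}$. **Theorem B.** Let $$\mathbf c_0(t)=\Bigl(\arctan t,\ \tfrac{\log(1+t^2)}{\sqrt2},\ t-\arctan t\Bigr),\qquad \alpha(t)=\frac{\pi(t+10)}{24},\qquad t\in I=[\tfrac1{10},\tfrac9{10}].$$ Then $\mathbf c_0$ is an embedded unit speed curve with $\kappa=\tau=\sqrt2/(1+t^2)$; the function $\mu=\kappa\cos\alpha$ satisfies $0<\mu$ and $\max_I\mu<\min_I\kappa$, and it is the curvature function of an embedded unit speed plane curve $\gamma$ on $I$. For all sufficiently small $\varepsilon_0>0$ the strips $f=f^{\alpha},\check f,f_*,\check f_*$ along $\mathbf c_0$ (respectively $\mathbf c_0^\sharp$) are embedded on $I\times(-\varepsilon_0,\varepsilon_0)$ with vanishing Gaussian curvature, and the geodesic curvature of the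 crease $v=0$ in each of them is $\mu$, so that all four have the crease $\mathbf c_0(I)$ and the crease pattern $\gamma(I)$. Moreover there is such an $\varepsilon_0$ for which the following holds for every $\varepsilon\in(0,\varepsilon_0]$: the four curved foldings $P_1(\varepsilon),\dots,P_4(\varepsilon)$ are pairwise non-congruent, that is, no isometry of $\mathbb R^3$ maps one of them onto another; and, more strongly, if $\delta\in(0,\varepsilon]$ and an isometry $T$ of $\mathbb R^3$ satisfies $T(P_i(\delta))\subset P_j(\varepsilon)$, then $i=j$. -/

import Mathlib

open scoped ContDiff RealInnerProductSpace

namespace CurvedFolding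

/-- Euclidean `3`-space. -/
abbrev E3 : Type := EuclideanSpace ℝ (Fin 3)

/-- Euclidean plane. -/
abbrev E2 : Type := EuclideanSpace ℝ (Fin 2)

noncomputable section

/-- The vector product of Euclidean `3`-space. -/
def cross (x y : E3) : E3 := WithLp.toLp 2 (crossProduct x.ofLp y.ofLp)

/-! ### Frenet frame of a unit speed space curve -/

/-- Unit tangent vector field. -/
def tangent (c : ℝ → E3) (t : ℝ) : E3 := deriv c t

/-- Curvature function. -/
def curvature (c : ℝ → E3) (t : ℝ) : ℝ := ‖deriv (deriv c) t‖

/-- Unit principal normal vector field. -/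
def normal (c : ℝ → E3) (t : ℝ) : E3 := (curvature c t)⁻¹ • deriv (deriv c) t

/-- Unit binormal vector field. -/
def binormal (c : ℝ → E3) (t : ℝ) : E3 := cross (tangent c t) (normal c t)

/-- Torsion function, with the sign convention `τ = n' · b`. -/
def torsion (c : ℝ → E3) (t : ℝ) : ℝ := ⟪deriv (normal c) t, binormal c t⟫

/-- The signed curvature of a unit speed plane curve. -/
def planeCurvature (γ : ℝ → E2) (t : ℝ) : ℝ :=
  deriv γ t 0 * deriv (deriv γ) t 1 - deriv γ t 1 * deriv (deriv γ) t 0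

/-! ### Parametrized surfaces -/

/-- The partial derivative `f_t`. -/
def dt (f : ℝ → ℝ → E3) (t v : ℝ) : E3 := deriv (fun s => f s v) t

/-- The partial derivative `f_v`. -/
def dv (f : ℝ → ℝ → E3) (t v : ℝ) : E3 := deriv (fun w => f t w) v

/-- The unit normal vector `f_t × f_v / |f_t × f_v|`. -/
def unitNormal (f : ℝ → ℝ → E3) (t v : ℝ) : E3 :=
  ‖cross (dt f t v) (dv f t v)‖⁻¹ • cross (dt f t v) (dv f t v)

/-- The Gaussian curvature `(L N - M ^ 2) / (E G - F ^ 2)`, at points where `f_t × f_v ≠ 0`. -/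
def gaussCurvature (f : ℝ → ℝ → E3) (t v : ℝ) : ℝ :=
  (⟪dt (dt f) t v, unitNormal f t v⟫ * ⟪dv (dv f) t v, unitNormal f t v⟫
      - ⟪dt (dv f) t v, unitNormal f t v⟫ ^ 2) /
    (⟪dt f t v, dt f t v⟫ * ⟪dv f t v, dv f t v⟫ - ⟪dt f t v, dv f t v⟫ ^ 2)

/-- The geodesic curvature of the curve `t ↦ f (t, 0)` (assumed to have unit speed) on the
surface `f`: the component of the acceleration along the unit co-normal `ν × f_t`. -/
def geodesicCurvature (f : ℝ → ℝ → E3) (t : ℝ) : ℝ :=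
  ⟪dt (dt f) t 0, cross (unitNormal f t 0) (dt f t 0)⟫

/-! ### Developable strips -/

/-- The normalized ruling vector field with angular functions `α` and `β`. -/
def ruling (c : ℝ → E3) (α β : ℝ → ℝ) (t : ℝ) : E3 :=
  Real.cos (β t) • tangent c t +
    Real.sin (β t) • (Real.cos (α t) • normal c t + Real.sin (α t) • binormal c t)

/-- `f` is, on `[a, b] × (-ε, ε)`, an embedded ruled surface along the curve `c` with first
angular function `α` whose Gaussian curvature vanishes identically. -/
structure IsDevelopableStrip (a b ε : ℝ) (c : ℝ → E3) (α : ℝ → ℝ) (f : ℝ → ℝ → E3) : Prop where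
  smooth_alpha : ContDiffOn ℝ ∞ α (Set.Icc a b)
  alpha_pos : ∀ t ∈ Set.Icc a b, 0 < |α t|
  alpha_lt : ∀ t ∈ Set.Icc a b, |α t| < Real.pi / 2
  ruled : ∃ β : ℝ → ℝ, ContDiffOn ℝ ∞ β (Set.Icc a b) ∧
    (∀ t ∈ Set.Icc a b, 0 < β t ∧ β t < Real.pi) ∧
    ∀ t ∈ Set.Icc a b, ∀ v ∈ Set.Ioo (-ε) ε, f t v = c t + v • ruling c α β t
  regular : ∀ t ∈ Set.Icc a b, ∀ v ∈ Set.Ioo (-ε) ε, cross (dt f t v) (dv f t v) ≠ 0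
  embedding : Topology.IsEmbedding
    (fun p : (Set.Icc a b ×ˢ Set.Ioo (-ε) ε : Set (ℝ × ℝ)) => f p.1.1 p.1.2)
  flat : ∀ t ∈ Set.Icc a b, ∀ v ∈ Set.Ioo (-ε) ε, gaussCurvature f t v = 0

/-- The second angular function determined by `α`: the number in `(0, π)` whose cotangent is
`(α' + τ) / (κ sin α)`. -/
def secondAngle (c : ℝ → E3) (α : ℝ → ℝ) (t : ℝ) : ℝ :=
  Real.pi / 2 - Real.arctan ((deriv α t + torsion c t) / (curvature c t * Real.sin (α t)))

/-- The developable strip `f^α` along `c` with first angular function `α`. -/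
def strip (c : ℝ → E3) (α : ℝ → ℝ) (t v : ℝ) : E3 :=
  c t + v • ruling c α (secondAngle c α) t

/-- The origami map of `f^α`: it is `f^α` for `v ≥ 0` and the dual `f^(-α)` for `v < 0`. -/
def origami (c : ℝ → E3) (α : ℝ → ℝ) (t v : ℝ) : E3 :=
  if 0 ≤ v then strip c α t v else strip c (-α) t v

/-! ### The four curved foldings -/

/-- The curve `c` on `[a, b]` with reversed orientation. -/
def reversed (a b : ℝ) (c : ℝ → E3) (t : ℝ) : E3 := c (-t + a + b)

/-- The first angular function of the inverse of `f^α`, that is, the function `α_*` with values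
in `(0, π/2)` such that `κ^♯ cos α_* = κ cos α`, where `κ^♯` is the curvature of the reversed
curve. -/
def inverseAngle (a b : ℝ) (c : ℝ → E3) (α : ℝ → ℝ) (t : ℝ) : ℝ :=
  Real.arccos (curvature c t * Real.cos (α t) / curvature (reversed a b c) t)

/-- The curves along which `f`, its dual, its inverse and its inverse dual are built. -/
def curveOf (a b : ℝ) (c : ℝ → E3) : Fin 4 → ℝ → E3 :=
  ![c, c, reversed a b c, reversed a b c]

/-- The first angular functions of `f = f^α`, its dual, its inverse and its inverse dual. -/
def angleOf (a b : ℝ) (c : ℝ → E3) (α : ℝ → ℝ) : Fin 4 → ℝ → ℝ :=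
  ![α, -α, inverseAngle a b c α, -inverseAngle a b c α]

/-- The four curved foldings: the images of `[a, b] × (-δ, δ)` under the origami maps of
`f = f^α`, its dual, its inverse and its inverse dual. -/
def folding (a b : ℝ) (c : ℝ → E3) (α : ℝ → ℝ) (i : Fin 4) (δ : ℝ) : Set E3 :=
  (fun p : ℝ × ℝ => origami (curveOf a b c i) (angleOf a b c α i) p.1 p.2) ''
    (Set.Icc a b ×ˢ Set.Ioo (-δ) δ)

/-! ### The explicit example -/

/-- The crease `c₀`. -/
def c₀ (t : ℝ) : E3 :=
  !₂[Real.arctan t, Real.log (1 + t ^ 2) / √2, t - Real.arctan t]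

/-- The first angular function. -/
def α₀ (t : ℝ) : ℝ := Real.pi * (t + 10) / 24

/-- The interval `[1/10, 9/10]`. -/
def I₀ : Set ℝ := Set.Icc (1 / 10) (9 / 10)

/-- The curvature function of the crease pattern. -/
def μ₀ (t : ℝ) : ℝ := curvature c₀ t * Real.cos (α₀ t)

end

end CurvedFolding

open CurvedFolding

namespace CurvedFolding

open Set Filter Topology

/-! ### Local diffeomorphisms near a segment -/

/-! Write ξ_α for the ruling of f^α. The map (t, x, y) ↦ c + x ξ_α + y ξ_{-α} (`spread`) is a
diffeomorphism near the crease, because the tangent and the two rulings are independent there. In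
these coordinates a folding is a pair of half planes, y = 0 ≤ x and x = 0 ≥ y, and embeddedness of
the strips is immediate. Flatness holds because the choice of β makes ξ' tangent to the strip; the
geodesic curvature of the crease is κ cos α, which is μ in all four cases.

For non-congruence, suppose an isometry maps one folding into another. At a point off the crease,
differentiating xy = 0 puts all velocities of curves in the folding into one plane; at a crease
point the velocities span space. So crease goes to crease (`exists_crease_eq`). All four creases are
the arc c₀(I₀), whose curvature is strictly decreasing; an isometry of this arc into itself
preserves speed and curvature, hence fixes its points, and it is the identity because the tangents
of c₀ span space (`eq_id_of_mapsTo_crease`).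

What remains is an inclusion of foldings with the same crease. Their tangent half planes agree along
it, hence so do the oriented angles with the osculating plane (`angle_eq_of_subset`). At c₀(u) these
angles are ±α(u) and ∓α_*(1 - u), with cosines μ(u)/κ(u) and μ(1 - u)/κ(u). As μ is strictly
decreasing, the four angles differ at u = 1/4 (`eq_of_creaseAngle_eq`). -/

/-- `Ψ` is injective with invertible derivative on the box `[a, b] × [-ε, ε] × [-ε, ε]`. -/
structure IsFoldChart (a b ε : ℝ) (Ψ : ℝ × ℝ × ℝ → E3) : Prop where
  injOn : InjOn Ψ (Icc a b ×ˢ Icc (-ε) ε ×ˢ Icc (-ε) ε)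
  contDiffAt : ∀ z ∈ Icc a b ×ˢ Icc (-ε) ε ×ˢ Icc (-ε) ε, ContDiffAt ℝ 1 Ψ z
  invertible : ∀ z ∈ Icc a b ×ˢ Icc (-ε) ε ×ˢ Icc (-ε) ε,
    ∃ A : (ℝ × ℝ × ℝ) ≃L[ℝ] E3, (A : (ℝ × ℝ × ℝ) →L[ℝ] E3) = fderiv ℝ Ψ z

theorem IsFoldChart.mono {a b ε ε' : ℝ} {Ψ : ℝ × ℝ × ℝ → E3} (h : IsFoldChart a b ε Ψ)
    (hε : ε' ≤ ε) : IsFoldChart a b ε' Ψ := by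
  have hs : Icc a b ×ˢ Icc (-ε') ε' ×ˢ Icc (-ε') ε' ⊆ Icc a b ×ˢ Icc (-ε) ε ×ˢ Icc (-ε) ε :=
    prod_mono le_rfl (prod_mono (Icc_subset_Icc (by linarith) hε)
      (Icc_subset_Icc (by linarith) hε))
  exact ⟨h.injOn.mono hs, fun z hz => h.contDiffAt z (hs hz), fun z hz => h.invertible z (hs hz)⟩

theorem IsFoldChart.continuousOn {a b ε : ℝ} {Ψ : ℝ × ℝ × ℝ → E3} (h : IsFoldChart a b ε Ψ) :
    ContinuousOn Ψ (Icc a b ×ˢ Icc (-ε) ε ×ˢ Icc (-ε) ε) :=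
  fun z hz => (h.contDiffAt z hz).continuousAt.continuousWithinAt

theorem IsFoldChart.isEmbedding {a b ε : ℝ} {Ψ : ℝ × ℝ × ℝ → E3} (h : IsFoldChart a b ε Ψ) :
    IsEmbedding ((Icc a b ×ˢ Icc (-ε) ε ×ˢ Icc (-ε) ε).domRestrict Ψ) := by
  have : CompactSpace (Icc a b ×ˢ Icc (-ε) ε ×ˢ Icc (-ε) ε : Set (ℝ × ℝ × ℝ)) :=
    isCompact_iff_compactSpace.1 (isCompact_Icc.prod (isCompact_Icc.prod isCompact_Icc))
  exact ((continuousOn_iff_continuous_domRestrict.1 h.continuousOn).isClosedEmbedding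
    (injOn_iff_injective.1 h.injOn)).isEmbedding

/-- Local injectivity at each point of a compact set, together with injectivity on that set, gives
injectivity on a neighbourhood; smoothness and invertibility of the derivative are open conditions.
By the tube lemma the neighbourhood contains a box around the segment. -/
theorem exists_isFoldChart {a b : ℝ} {Ψ : ℝ × ℝ × ℝ → E3}
    (hΨ : ∀ t ∈ Icc a b, ContDiffAt ℝ 1 Ψ (t, 0, 0))
    (hinv : ∀ t ∈ Icc a b,
      ∃ A : (ℝ × ℝ × ℝ) ≃L[ℝ] E3, (A : (ℝ × ℝ × ℝ) →L[ℝ] E3) = fderiv ℝ Ψ (t, 0, 0))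
    (hinj : InjOn (fun t => Ψ (t, 0, 0)) (Icc a b)) : ∃ ε > 0, IsFoldChart a b ε Ψ := by
  set C : Set (ℝ × ℝ × ℝ) := Icc a b ×ˢ {0} with hC
  have hCc : IsCompact C := isCompact_Icc.prod isCompact_singleton
  have hmem : ∀ z ∈ C, z.1 ∈ Icc a b ∧ z = (z.1, 0, 0) := by
    rintro ⟨t, x, y⟩ ⟨ht, hxy⟩
    simp only [mem_singleton_iff, Prod.mk_eq_zero] at hxy
    exact ⟨ht, by simp [hxy.1, hxy.2]⟩
  have hd : ∀ z ∈ C, ContDiffAt ℝ 1 Ψ z := fun z hz => by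
    rw [(hmem z hz).2]; exact hΨ _ (hmem z hz).1
  have hA : ∀ z ∈ C, ∃ A : (ℝ × ℝ × ℝ) ≃L[ℝ] E3,
      (A : (ℝ × ℝ × ℝ) →L[ℝ] E3) = fderiv ℝ Ψ z := fun z hz => by
    rw [(hmem z hz).2]; exact hinv _ (hmem z hz).1
  have hi : InjOn Ψ C := by
    intro z hz w hw h
    have h1 := hmem z hz
    have h2 := hmem w hw
    rw [h1.2, h2.2] at h ⊢
    rw [hinj h1.1 h2.1 h]
  obtain ⟨U, hU, hUinj⟩ := hi.exists_mem_nhdsSet hCc (fun z hz => (hd z hz).continuousAt) (by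
    intro z hz
    obtain ⟨A, hA⟩ := hA z hz
    have hs : HasStrictFDerivAt Ψ (A : (ℝ × ℝ × ℝ) →L[ℝ] E3) z := by
      rw [hA]; exact (hd z hz).hasStrictFDerivAt one_ne_zero
    exact ⟨_, (hs.toOpenPartialHomeomorph Ψ).open_source.mem_nhds
      hs.mem_toOpenPartialHomeomorph_source, (hs.toOpenPartialHomeomorph Ψ).injOn⟩)
  have hV : ∀ᶠ z in 𝓝ˢ C, ContDiffAt ℝ 1 Ψ z ∧ ∃ A : (ℝ × ℝ × ℝ) ≃L[ℝ] E3,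
      (A : (ℝ × ℝ × ℝ) →L[ℝ] E3) = fderiv ℝ Ψ z := by
    rw [eventually_nhdsSet_iff_forall]
    intro z hz
    refine ((hd z hz).eventually (by simp)).and ?_
    have hc : ContinuousAt (fderiv ℝ Ψ) z :=
      ((hd z hz).fderiv_right (m := 0) (by simp)).continuousAt
    exact hc.eventually_mem (ContinuousLinearEquiv.isOpen.mem_nhds (hA z hz))
  have hW := (eventually_of_mem hU (fun _ h => h)).and hV
  rw [hC, isCompact_Icc.nhdsSet_prod_eq isCompact_singleton] at hW
  obtain ⟨S, hS, B, hB, hSB⟩ := mem_prod_iff.1 hW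
  rw [nhdsSet_singleton] at hB
  obtain ⟨r, hr, hrB⟩ := Metric.mem_nhds_iff.1 hB
  have hsub : ∀ z ∈ Icc a b ×ˢ Icc (-(r / 2)) (r / 2) ×ˢ Icc (-(r / 2)) (r / 2),
      z ∈ U ∧ ContDiffAt ℝ 1 Ψ z ∧ ∃ A : (ℝ × ℝ × ℝ) ≃L[ℝ] E3,
      (A : (ℝ × ℝ × ℝ) →L[ℝ] E3) = fderiv ℝ Ψ z := by
    rintro ⟨t, x, y⟩ ⟨ht, hx, hy⟩
    refine hSB (show (t, (x, y)) ∈ S ×ˢ B from ⟨subset_of_mem_nhdsSet hS ht, hrB ?_⟩)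
    rw [mem_ball_zero_iff, Prod.norm_mk, max_lt_iff, Real.norm_eq_abs, Real.norm_eq_abs]
    exact ⟨(abs_le.2 hx).trans_lt (by linarith), (abs_le.2 hy).trans_lt (by linarith)⟩
  exact ⟨r / 2, by positivity, fun z hz w hw h => hUinj (hsub z hz).1 (hsub w hw).1 h,
    fun z hz => (hsub z hz).2.1, fun z hz => (hsub z hz).2.2⟩

/-- A curve that is one-sidedly differentiable and runs in the image of a fold chart lifts to a
one-sidedly differentiable curve. -/
theorem IsFoldChart.hasDerivWithinAt_lift {a b ε : ℝ} {Ψ : ℝ × ℝ × ℝ → E3}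
    (h : IsFoldChart a b ε Ψ) {x : ℝ → E3} {z : ℝ → ℝ × ℝ × ℝ} {S : Set ℝ} {s : ℝ} {w : E3}
    (hs : s ∈ S) (hz : ∀ r ∈ S, z r ∈ Icc a b ×ˢ Icc (-ε) ε ×ˢ Icc (-ε) ε)
    (hxz : ∀ r ∈ S, Ψ (z r) = x r) (hx : HasDerivWithinAt x w S s) :
    ∃ k, fderiv ℝ Ψ (z s) k = w ∧ HasDerivWithinAt z k S s := by
  -- The local inverse sees `z` only near `z s`, so continuity of the lift is needed beforehand; it
  -- comes from the global embedding.
  have hcont : Tendsto z (𝓝[S] s) (𝓝 (z s)) := by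
    rw [tendsto_nhdsWithin_iff_subtype hs]
    have h1 : Tendsto (fun r : S => (⟨z r, hz r r.2⟩ :
        (Icc a b ×ˢ Icc (-ε) ε ×ˢ Icc (-ε) ε : Set (ℝ × ℝ × ℝ)))) (𝓝 ⟨s, hs⟩)
        (𝓝 ⟨z s, hz s hs⟩) := by
      rw [h.isEmbedding.tendsto_nhds_iff]
      have h2 := (tendsto_nhdsWithin_iff_subtype hs x _).1 hx.continuousWithinAt
      have h3 : (Icc a b ×ˢ Icc (-ε) ε ×ˢ Icc (-ε) ε).domRestrict Ψ ⟨z s, hz s hs⟩ = x s := hxz s hs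
      rw [h3]
      exact h2.congr fun r => (hxz r r.2).symm
    exact (continuous_subtype_val.tendsto _).comp h1
  obtain ⟨A, hA⟩ := h.invertible _ (hz s hs)
  have hd : HasStrictFDerivAt Ψ (A : (ℝ × ℝ × ℝ) →L[ℝ] E3) (z s) := by
    rw [hA]; exact (h.contDiffAt _ (hz s hs)).hasStrictFDerivAt one_ne_zero
  refine ⟨A.symm w, by rw [← hA]; simp, ?_⟩
  have hl := hd.to_localInverse.hasFDerivAt
  rw [hxz s hs] at hl
  refine (hl.comp_hasDerivWithinAt s hx).congr_of_eventuallyEq ?_ ?_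
  · filter_upwards [hcont.eventually hd.eventually_left_inverse, self_mem_nhdsWithin] with r h1 h2
    rw [Function.comp_apply, ← hxz r h2, h1]
  · rw [Function.comp_apply, ← hxz s hs, hd.localInverse_apply_image]

/-- The two half planes in which a fold is flat, in the coordinates of a fold chart. -/
def bentSet (a b ε : ℝ) : Set (ℝ × ℝ × ℝ) :=
  {z | z ∈ Icc a b ×ˢ Icc (-ε) ε ×ˢ Icc (-ε) ε ∧ 0 ≤ z.2.1 ∧ z.2.2 ≤ 0 ∧ z.2.1 * z.2.2 = 0}

/-- The product rule applied to xy = 0. The resulting linear condition on the velocity is void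
exactly on the crease x = y = 0, which is how crease points are recognised. -/
theorem mul_add_mul_eq_zero_of_mem_bentSet {a b ε : ℝ} {z : ℝ → ℝ × ℝ × ℝ} {S : Set ℝ} {s : ℝ}
    {k : ℝ × ℝ × ℝ} (hs : s ∈ S) (hS : UniqueDiffWithinAt ℝ S s) (hz : ∀ r ∈ S, z r ∈ bentSet a b ε)
    (hd : HasDerivWithinAt z k S s) : k.2.1 * (z s).2.2 + (z s).2.1 * k.2.2 = 0 := by
  have h1 : HasDerivWithinAt (fun r => (z r).2.1) k.2.1 S s := hd.snd.fst
  have h2 : HasDerivWithinAt (fun r => (z r).2.2) k.2.2 S s := hd.snd.snd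
  have h3 : HasDerivWithinAt (fun _ : ℝ => (0 : ℝ)) (k.2.1 * (z s).2.2 + (z s).2.1 * k.2.2) S s :=
    (h1.mul h2).congr (fun r hr => (hz r hr).2.2.2.symm) (hz s hs).2.2.2.symm
  exact hS.eq_deriv _ h3 (hasDerivWithinAt_const _ _ _)

/-- On the crease the product rule gives nothing, but the difference quotients lie in the closed
cone x ≥ 0 ≥ y, xy = 0, and so does their limit. -/
theorem deriv_mem_of_mem_bentSet {a b ε δ : ℝ} (hδ : 0 < δ) {z : ℝ → ℝ × ℝ × ℝ}
    {k : ℝ × ℝ × ℝ} (hz : ∀ r ∈ Ico 0 δ, z r ∈ bentSet a b ε)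
    (h0 : (z 0).2 = 0) (hd : HasDerivWithinAt z k (Ico 0 δ) 0) :
    0 ≤ k.2.1 ∧ k.2.2 ≤ 0 ∧ k.2.1 * k.2.2 = 0 := by
  have hx : HasDerivWithinAt (fun r => (z r).2.1) k.2.1 (Ico 0 δ) 0 := hd.snd.fst
  have hy : HasDerivWithinAt (fun r => (z r).2.2) k.2.2 (Ico 0 δ) 0 := hd.snd.snd
  rw [hasDerivWithinAt_iff_tendsto_slope] at hx hy
  have hset : Ico 0 δ \ {0} = Ioo 0 δ := Ico_sdiff_left
  rw [hset] at hx hy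
  have hne : (𝓝[Ioo 0 δ] (0 : ℝ)).NeBot := by
    rw [nhdsWithin_Ioo_eq_nhdsGT hδ]; infer_instance
  have h01 : (z 0).2.1 = 0 := by rw [h0]; rfl
  have h02 : (z 0).2.2 = 0 := by rw [h0]; rfl
  have hev : ∀ᶠ r in 𝓝[Ioo 0 δ] (0 : ℝ), r ∈ Ioo 0 δ := self_mem_nhdsWithin
  refine ⟨ge_of_tendsto hx ?_, le_of_tendsto hy ?_, ?_⟩
  · filter_upwards [hev] with r hr
    have := (hz r ⟨hr.1.le, hr.2⟩).2.1
    have := hr.1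
    simp only [slope_def_field, h01, sub_zero]; positivity
  · filter_upwards [hev] with r hr
    have := (hz r ⟨hr.1.le, hr.2⟩).2.2.1
    simp only [slope_def_field, h02, sub_zero]
    exact div_nonpos_of_nonpos_of_nonneg this hr.1.le
  · refine tendsto_nhds_unique_of_eventuallyEq (hx.mul hy) tendsto_const_nhds ?_
    filter_upwards [hev] with r hr
    have := (hz r ⟨hr.1.le, hr.2⟩).2.2.2
    simp only [slope_def_field, h01, h02, sub_zero]
    rw [div_mul_div_comm, this, zero_div]

/-! ### The vector product -/

theorem inner_eq_sum (x y : E3) : ⟪x, y⟫ = x 0 * y 0 + x 1 * y 1 + x 2 * y 2 := by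
  simp [PiLp.inner_apply, Fin.sum_univ_three, mul_comm]

theorem cross_apply_zero (x y : E3) : cross x y 0 = x 1 * y 2 - x 2 * y 1 := by
  simp [cross, cross_apply]

theorem cross_apply_one (x y : E3) : cross x y 1 = x 2 * y 0 - x 0 * y 2 := by
  simp [cross, cross_apply]

theorem cross_apply_two (x y : E3) : cross x y 2 = x 0 * y 1 - x 1 * y 0 := by
  simp [cross, cross_apply]

theorem ext_E3 {x y : E3} (h0 : x 0 = y 0) (h1 : x 1 = y 1) (h2 : x 2 = y 2) : x = y := by
  ext i; fin_cases i <;> assumption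

theorem inner_cross_left (x y : E3) : ⟪x, cross x y⟫ = 0 := by
  rw [inner_eq_sum, cross_apply_zero, cross_apply_one, cross_apply_two]; ring

theorem inner_cross_right (x y : E3) : ⟪y, cross x y⟫ = 0 := by
  rw [inner_eq_sum, cross_apply_zero, cross_apply_one, cross_apply_two]; ring

theorem cross_add_smul_left (x y : E3) (p q : ℝ) :
    cross (p • x + q • y) y = p • cross x y := by
  apply ext_E3 <;> simp [cross_apply_zero, cross_apply_one, cross_apply_two] <;> ring

theorem cross_add_smul_right (x y : E3) (p q : ℝ) :
    cross x (p • x + q • y) = q • cross x y := by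
  apply ext_E3 <;> simp [cross_apply_zero, cross_apply_one, cross_apply_two] <;> ring

theorem cross_smul_left (x y : E3) (p : ℝ) : cross (p • x) y = p • cross x y := by
  apply ext_E3 <;> simp [cross_apply_zero, cross_apply_one, cross_apply_two] <;> ring

theorem cross_cross (x y : E3) : cross (cross x y) x = ⟪x, x⟫ • y - ⟪x, y⟫ • x := by
  apply ext_E3 <;> simp only [cross_apply_zero, cross_apply_one, cross_apply_two, inner_eq_sum,
    PiLp.sub_apply, PiLp.smul_apply, smul_eq_mul] <;> ring

theorem inner_cross_cross (x y : E3) :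
    ⟪cross x y, cross x y⟫ = ⟪x, x⟫ * ⟪y, y⟫ - ⟪x, y⟫ ^ 2 := by
  simp only [cross_apply_zero, cross_apply_one, cross_apply_two, inner_eq_sum]; ring

/-- If x × y = 0, then y × (x × y) = ⟪y, y⟫ x - ⟪x, y⟫ y is a vanishing combination whose first
coefficient is nonzero. -/
theorem cross_ne_zero {x y : E3} (h : ∀ p q : ℝ, p • x + q • y = 0 → p = 0) (hy : y ≠ 0) :
    cross x y ≠ 0 := by
  intro h0
  have h1 : ⟪y, y⟫ • x + (-⟪x, y⟫) • y = 0 := by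
    apply ext_E3 <;>
      simp only [inner_eq_sum, PiLp.add_apply, PiLp.smul_apply, smul_eq_mul, PiLp.zero_apply]
    all_goals
      have a0 : x 1 * y 2 - x 2 * y 1 = 0 := by rw [← cross_apply_zero, h0]; rfl
      have a1 : x 2 * y 0 - x 0 * y 2 = 0 := by rw [← cross_apply_one, h0]; rfl
      have a2 : x 0 * y 1 - x 1 * y 0 = 0 := by rw [← cross_apply_two, h0]; rfl
    · linear_combination y 1 * a2 - y 2 * a1
    · linear_combination y 2 * a0 - y 0 * a2
    · linear_combination y 0 * a1 - y 1 * a0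
  exact hy (inner_self_eq_zero.1 (h _ _ h1))

/-! ### Curves with a Frenet frame -/

/-- `T, N, B` is a smooth Frenet frame of the curve `c`, which has curvature `κ > 0` and
torsion `τ`. -/
structure FrenetCurve (c T N B : ℝ → E3) (κ τ : ℝ → ℝ) : Prop where
  contDiff_curve : ContDiff ℝ ∞ c
  contDiff_T : ContDiff ℝ ∞ T
  contDiff_N : ContDiff ℝ ∞ N
  contDiff_B : ContDiff ℝ ∞ B
  contDiff_κ : ContDiff ℝ ∞ κ
  contDiff_τ : ContDiff ℝ ∞ τ
  hasDerivAt_curve : ∀ t, HasDerivAt c (T t) t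
  hasDerivAt_T : ∀ t, HasDerivAt T (κ t • N t) t
  hasDerivAt_N : ∀ t, HasDerivAt N (-κ t • T t + τ t • B t) t
  hasDerivAt_B : ∀ t, HasDerivAt B (-τ t • N t) t
  TT : ∀ t, ⟪T t, T t⟫ = 1
  NN : ∀ t, ⟪N t, N t⟫ = 1
  BB : ∀ t, ⟪B t, B t⟫ = 1
  TN : ∀ t, ⟪T t, N t⟫ = 0
  TB : ∀ t, ⟪T t, B t⟫ = 0
  NB : ∀ t, ⟪N t, B t⟫ = 0
  cross_eq : ∀ t, cross (T t) (N t) = B t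
  κ_pos : ∀ t, 0 < κ t

/-- Admissible first angular functions on `[a, b]`. -/
structure IsAngle (a b : ℝ) (α : ℝ → ℝ) : Prop where
  contDiffAt : ∀ t ∈ Icc a b, ContDiffAt ℝ ∞ α t
  pos : ∀ t ∈ Icc a b, 0 < |α t|
  lt : ∀ t ∈ Icc a b, |α t| < Real.pi / 2

theorem IsAngle.neg {a b : ℝ} {α : ℝ → ℝ} (h : IsAngle a b α) : IsAngle a b (-α) :=
  ⟨fun t ht => (h.contDiffAt t ht).neg, fun t ht => by simpa using h.pos t ht,
    fun t ht => by simpa using h.lt t ht⟩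

theorem IsAngle.cos_pos {a b : ℝ} {α : ℝ → ℝ} (h : IsAngle a b α) {t : ℝ} (ht : t ∈ Icc a b) :
    0 < Real.cos (α t) :=
  Real.cos_pos_of_mem_Ioo ⟨(abs_lt.1 (h.lt t ht)).1, (abs_lt.1 (h.lt t ht)).2⟩

theorem IsAngle.sin_ne_zero {a b : ℝ} {α : ℝ → ℝ} (h : IsAngle a b α) {t : ℝ}
    (ht : t ∈ Icc a b) : Real.sin (α t) ≠ 0 := by
  have h1 := abs_lt.1 (h.lt t ht)
  rcases lt_or_gt_of_ne (abs_pos.1 (h.pos t ht)) with h2 | h2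
  · exact (Real.sin_neg_of_neg_of_neg_pi_lt h2 (by linarith [Real.pi_pos])).ne
  · exact (Real.sin_pos_of_pos_of_lt_pi h2 (by linarith [Real.pi_pos])).ne'

/-! ### The second angular function -/

section Angle

variable (c : ℝ → E3) (α : ℝ → ℝ) (t : ℝ)

theorem secondAngle_pos : 0 < secondAngle c α t := by
  rw [secondAngle]; linarith [Real.arctan_lt_pi_div_two
    ((deriv α t + torsion c t) / (curvature c t * Real.sin (α t)))]

theorem secondAngle_lt_pi : secondAngle c α t < Real.pi := by
  rw [secondAngle]; linarith [Real.neg_pi_div_two_lt_arctan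
    ((deriv α t + torsion c t) / (curvature c t * Real.sin (α t)))]

theorem sin_secondAngle_pos : 0 < Real.sin (secondAngle c α t) :=
  Real.sin_pos_of_pos_of_lt_pi (secondAngle_pos c α t) (secondAngle_lt_pi c α t)

theorem cos_secondAngle : Real.cos (secondAngle c α t) =
    (deriv α t + torsion c t) / (curvature c t * Real.sin (α t)) *
      Real.sin (secondAngle c α t) := by
  rw [secondAngle, Real.cos_pi_div_two_sub, Real.sin_pi_div_two_sub, Real.sin_arctan,
    Real.cos_arctan]
  ring

end Angle

/-! ### The two strips of a fold as one map of three variables -/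

/-- The two half strips of a fold, spread out to a map of three variables. -/
noncomputable def spread (c : ℝ → E3) (α : ℝ → ℝ) (z : ℝ × ℝ × ℝ) : E3 :=
  c z.1 + z.2.1 • ruling c α (secondAngle c α) z.1 + z.2.2 • ruling c (-α) (secondAngle c (-α)) z.1

theorem strip_eq_spread (c : ℝ → E3) (α : ℝ → ℝ) (t v : ℝ) :
    strip c α t v = spread c α (t, v, 0) := by simp [strip, spread]

theorem strip_neg_eq_spread (c : ℝ → E3) (α : ℝ → ℝ) (t v : ℝ) :
    strip c (-α) t v = spread c α (t, 0, v) := by simp [strip, spread]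

theorem spread_zero (c : ℝ → E3) (α : ℝ → ℝ) (t : ℝ) : spread c α (t, 0, 0) = c t := by
  simp [spread]

namespace FrenetCurve

variable {c T N B : ℝ → E3} {κ τ : ℝ → ℝ}

theorem tangent_eq (F : FrenetCurve c T N B κ τ) : tangent c = T :=
  funext fun t => (F.hasDerivAt_curve t).deriv

theorem deriv_eq (F : FrenetCurve c T N B κ τ) : deriv c = T :=
  funext fun t => (F.hasDerivAt_curve t).deriv

theorem deriv_deriv_eq (F : FrenetCurve c T N B κ τ) (t : ℝ) : deriv (deriv c) t = κ t • N t := by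
  rw [F.deriv_eq, (F.hasDerivAt_T t).deriv]

theorem norm_T (F : FrenetCurve c T N B κ τ) (t : ℝ) : ‖T t‖ = 1 := by
  rw [norm_eq_sqrt_real_inner, F.TT, Real.sqrt_one]

theorem norm_N (F : FrenetCurve c T N B κ τ) (t : ℝ) : ‖N t‖ = 1 := by
  rw [norm_eq_sqrt_real_inner, F.NN, Real.sqrt_one]

theorem curvature_eq (F : FrenetCurve c T N B κ τ) : curvature c = κ := funext fun t => by
  rw [curvature, F.deriv_deriv_eq, norm_smul, F.norm_N, mul_one, Real.norm_eq_abs,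
    abs_of_pos (F.κ_pos t)]

theorem normal_eq (F : FrenetCurve c T N B κ τ) : normal c = N := funext fun t => by
  rw [normal, F.curvature_eq, F.deriv_deriv_eq, smul_smul, inv_mul_cancel₀ (F.κ_pos t).ne',
    one_smul]

theorem binormal_eq (F : FrenetCurve c T N B κ τ) : binormal c = B := funext fun t => by
  rw [binormal, F.tangent_eq, F.normal_eq, F.cross_eq]

theorem torsion_eq (F : FrenetCurve c T N B κ τ) : torsion c = τ := funext fun t => by
  rw [torsion, F.normal_eq, F.binormal_eq, (F.hasDerivAt_N t).deriv, inner_add_left,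
    real_inner_smul_left, real_inner_smul_left, F.TB, F.BB]
  ring

theorem ruling_eq (F : FrenetCurve c T N B κ τ) (α β : ℝ → ℝ) (t : ℝ) :
    ruling c α β t = Real.cos (β t) • T t +
      Real.sin (β t) • (Real.cos (α t) • N t + Real.sin (α t) • B t) := by
  rw [ruling, F.tangent_eq, F.normal_eq, F.binormal_eq]

theorem inner_N_ruling (F : FrenetCurve c T N B κ τ) (α β : ℝ → ℝ) (t : ℝ) :
    ⟪N t, ruling c α β t⟫ = Real.sin (β t) * Real.cos (α t) := by
  simp only [F.ruling_eq, inner_add_right, real_inner_smul_right, F.NB, F.NN,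
    real_inner_comm (T t) (N t), F.TN]
  ring

theorem inner_B_ruling (F : FrenetCurve c T N B κ τ) (α β : ℝ → ℝ) (t : ℝ) :
    ⟪B t, ruling c α β t⟫ = Real.sin (β t) * Real.sin (α t) := by
  simp only [F.ruling_eq, inner_add_right, real_inner_smul_right, F.BB,
    real_inner_comm (T t) (B t), F.TB, real_inner_comm (N t) (B t), F.NB]
  ring

theorem contDiffAt_secondAngle (F : FrenetCurve c T N B κ τ) {a b : ℝ} {α : ℝ → ℝ}
    (hα : IsAngle a b α) {t : ℝ} (ht : t ∈ Icc a b) : ContDiffAt ℝ ∞ (secondAngle c α) t := by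
  have h1 := hα.contDiffAt t ht
  have h2 : ContDiffAt ℝ ∞ (deriv α) t := h1.derivWithin (by simp)
  have h3 := F.contDiff_κ.contDiffAt (x := t)
  have h4 := F.contDiff_τ.contDiffAt (x := t)
  have h5 : κ t * Real.sin (α t) ≠ 0 := mul_ne_zero (F.κ_pos t).ne' (hα.sin_ne_zero ht)
  have h6 : secondAngle c α = fun t => Real.pi / 2 -
      Real.arctan ((deriv α t + τ t) / (κ t * Real.sin (α t))) := by
    funext s; rw [secondAngle, F.curvature_eq, F.torsion_eq]
  rw [h6]
  exact contDiffAt_const.sub (((h2.add h4).div (h3.mul h1.sin) h5).arctan)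

theorem contDiffAt_ruling (F : FrenetCurve c T N B κ τ) {a b : ℝ} {α : ℝ → ℝ}
    (hα : IsAngle a b α) {t : ℝ} (ht : t ∈ Icc a b) :
    ContDiffAt ℝ ∞ (ruling c α (secondAngle c α)) t := by
  have h1 := hα.contDiffAt t ht
  have h2 := F.contDiffAt_secondAngle hα ht
  rw [funext (F.ruling_eq α (secondAngle c α))]
  exact (h2.cos.smul F.contDiff_T.contDiffAt).add (h2.sin.smul
    ((h1.cos.smul F.contDiff_N.contDiffAt).add (h1.sin.smul F.contDiff_B.contDiffAt)))

/-- The defining property of developable strips: `ξ'` is tangent to the strip. -/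
theorem exists_hasDerivAt_ruling (F : FrenetCurve c T N B κ τ) {a b : ℝ} {α : ℝ → ℝ}
    (hα : IsAngle a b α) {t : ℝ} (ht : t ∈ Icc a b) :
    ∃ p q : ℝ, HasDerivAt (ruling c α (secondAngle c α))
      (p • T t + q • ruling c α (secondAngle c α) t) t := by
  have h1 := ((hα.contDiffAt t ht).differentiableAt (by simp)).hasDerivAt
  have h2 := ((F.contDiffAt_secondAngle hα ht).differentiableAt (by simp)).hasDerivAt
  have hs := sin_secondAngle_pos c α t
  have hc := cos_secondAngle c α t
  have hd := (h2.cos.smul (F.hasDerivAt_T t)).add (h2.sin.smul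
    ((h1.cos.smul (F.hasDerivAt_N t)).add (h1.sin.smul (F.hasDerivAt_B t))))
  have hκ := (F.κ_pos t).ne'
  have hsa := hα.sin_ne_zero ht
  rw [F.curvature_eq, F.torsion_eq] at hc
  set β := secondAngle c α
  have hc' : κ t * Real.cos (β t) * Real.sin (α t) = Real.sin (β t) * (deriv α t + τ t) := by
    rw [hc]; field_simp
  have hsc := Real.sin_sq_add_cos_sq (β t)
  have hsc' := Real.sin_sq_add_cos_sq (α t)
  -- Put m = cos α N + sin α B. The component of ξ' along -sin α N + cos α B vanishes by `hc'`. The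
  -- components along T and m are -(β' + κ cos α) sin β and (β' + κ cos α) cos β; solving p T + q ξ
  -- = ξ' for them gives these values.
  refine ⟨-(deriv β t + κ t * Real.cos (α t)) / Real.sin (β t),
    (deriv β t + κ t * Real.cos (α t)) * Real.cos (β t) / Real.sin (β t), ?_⟩
  have hf : ruling c α β = fun t => Real.cos (β t) • T t +
      Real.sin (β t) • (Real.cos (α t) • N t + Real.sin (α t) • B t) := funext (F.ruling_eq α β)
  rw [hf]
  refine HasDerivAt.congr_deriv (f := fun t => Real.cos (β t) • T t +
      Real.sin (β t) • (Real.cos (α t) • N t + Real.sin (α t) • B t)) hd ?_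
  simp only [Pi.add_apply, Pi.smul_apply']
  match_scalars
  · field_simp
    linear_combination Real.sin (α t) * hc' - κ t * Real.cos (β t) * hsc'
  · field_simp
    linear_combination -(deriv β t + κ t * Real.cos (α t)) * hsc
  · field_simp
    linear_combination -Real.cos (α t) * hc'

theorem contDiffAt_spread (F : FrenetCurve c T N B κ τ) {a b : ℝ} {α : ℝ → ℝ}
    (hα : IsAngle a b α) {t : ℝ} (ht : t ∈ Icc a b) (w : ℝ × ℝ) :
    ContDiffAt ℝ ∞ (spread c α) (t, w) := by
  have h1 := F.contDiffAt_ruling hα ht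
  have h2 := F.contDiffAt_ruling hα.neg ht
  have hf : ContDiffAt ℝ ∞ (fun z : ℝ × ℝ × ℝ => z.1) (t, w) := contDiffAt_fst
  have hx : ContDiffAt ℝ ∞ (fun z : ℝ × ℝ × ℝ => z.2.1) (t, w) := contDiffAt_snd.fst
  have hy : ContDiffAt ℝ ∞ (fun z : ℝ × ℝ × ℝ => z.2.2) (t, w) := contDiffAt_snd.snd
  have k0 : ContDiffAt ℝ ∞ (fun z : ℝ × ℝ × ℝ => c z.1) (t, w) :=
    F.contDiff_curve.contDiffAt.comp (t, w) hf
  have k1 : ContDiffAt ℝ ∞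
      (fun z : ℝ × ℝ × ℝ => ruling c α (secondAngle c α) z.1) (t, w) :=
    ContDiffAt.comp (g := ruling c α (secondAngle c α)) (t, w) h1 hf
  have k2 : ContDiffAt ℝ ∞
      (fun z : ℝ × ℝ × ℝ => ruling c (-α) (secondAngle c (-α)) z.1) (t, w) :=
    ContDiffAt.comp (g := ruling c (-α) (secondAngle c (-α))) (t, w) h2 hf
  exact (k0.add (hx.smul k1)).add (hy.smul k2)

theorem fderiv_spread (F : FrenetCurve c T N B κ τ) {a b : ℝ} {α : ℝ → ℝ}
    (hα : IsAngle a b α) {t : ℝ} (ht : t ∈ Icc a b) (w k : ℝ × ℝ) (r : ℝ) :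
    fderiv ℝ (spread c α) (t, w) (r, k) =
      r • (T t + w.1 • deriv (ruling c α (secondAngle c α)) t +
        w.2 • deriv (ruling c (-α) (secondAngle c (-α))) t) +
      k.1 • ruling c α (secondAngle c α) t + k.2 • ruling c (-α) (secondAngle c (-α)) t := by
  have h1 := ((F.contDiffAt_ruling hα ht).differentiableAt (by simp)).hasDerivAt
  have h2 := ((F.contDiffAt_ruling hα.neg ht).differentiableAt (by simp)).hasDerivAt
  have hd := ((F.contDiffAt_spread hα ht w).differentiableAt (by simp)).hasFDerivAt
  -- The derivative is read off along the straight line through (t, w) with direction (r, k).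
  have hl : HasDerivAt (fun s : ℝ => (t + s * r, w + s • k)) (r, k) 0 := by
    have h3 : HasDerivAt (fun s : ℝ => t + s * r) (1 * r) 0 :=
      ((hasDerivAt_id 0).mul_const r).const_add t
    have h4 : HasDerivAt (fun s : ℝ => w + s • k) ((1 : ℝ) • k) 0 :=
      ((hasDerivAt_id 0).smul_const k).const_add w
    simpa using h3.prodMk h4
  have hl0 : (t + 0 * r, w + (0 : ℝ) • k) = (t, w) := by simp
  have h5 := HasFDerivAt.comp_hasDerivAt (f := fun s : ℝ => (t + s * r, w + s • k)) 0
    (by rw [hl0]; exact hd) hl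
  have g0 : HasDerivAt (fun s : ℝ => t + s * r) r 0 := by
    simpa using ((hasDerivAt_id (0 : ℝ)).mul_const r).const_add t
  have g1 : HasDerivAt (fun s : ℝ => w.1 + s * k.1) k.1 0 := by
    simpa using ((hasDerivAt_id (0 : ℝ)).mul_const k.1).const_add w.1
  have g2 : HasDerivAt (fun s : ℝ => w.2 + s * k.2) k.2 0 := by
    simpa using ((hasDerivAt_id (0 : ℝ)).mul_const k.2).const_add w.2
  have e0 : t + 0 * r = t := by simp
  have c0 := HasDerivAt.scomp (𝕜' := ℝ) (0 : ℝ) (by rw [e0]; exact F.hasDerivAt_curve t) g0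
  have c1 := HasDerivAt.scomp (𝕜' := ℝ) (0 : ℝ) (by rw [e0]; exact h1) g0
  have c2 := HasDerivAt.scomp (𝕜' := ℝ) (0 : ℝ) (by rw [e0]; exact h2) g0
  have h6 := (c0.add (g1.smul c1)).add (g2.smul c2)
  have h7 := HasDerivAt.unique h5 h6
  rw [h7]
  simp only [Function.comp_apply, zero_mul, add_zero]
  module

/-- Modulo T, the two rulings are positive multiples of cos α N ± sin α B. These are independent
because neither cos α nor sin α vanishes. -/
theorem linearIndependent_rulings (F : FrenetCurve c T N B κ τ) {a b : ℝ} {α : ℝ → ℝ}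
    (hα : IsAngle a b α) {t : ℝ} (ht : t ∈ Icc a b) {x y z : ℝ}
    (h : x • T t + y • ruling c α (secondAngle c α) t +
      z • ruling c (-α) (secondAngle c (-α)) t = 0) : x = 0 ∧ y = 0 ∧ z = 0 := by
  have hN := congrArg (fun v => ⟪N t, v⟫) h
  have hB := congrArg (fun v => ⟪B t, v⟫) h
  simp only [inner_add_right, real_inner_smul_right, F.inner_N_ruling, F.inner_B_ruling,
    inner_zero_right, real_inner_comm (T t), F.TN, F.TB, Pi.neg_apply, Real.cos_neg,
    Real.sin_neg] at hN hB
  have hs := (sin_secondAngle_pos c α t).ne'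
  have hs' := (sin_secondAngle_pos c (-α) t).ne'
  have hsa := hα.sin_ne_zero ht
  have hca := (hα.cos_pos ht).ne'
  have e1 : y * Real.sin (secondAngle c α t) + z * Real.sin (secondAngle c (-α) t) = 0 :=
    mul_right_cancel₀ hca (by linear_combination hN)
  have e2 : y * Real.sin (secondAngle c α t) - z * Real.sin (secondAngle c (-α) t) = 0 :=
    mul_right_cancel₀ hsa (by linear_combination hB)
  have hy : y = 0 := by
    have : y * Real.sin (secondAngle c α t) = 0 := by linarith
    exact (mul_eq_zero.1 this).resolve_right hs
  have hz : z = 0 := by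
    have : z * Real.sin (secondAngle c (-α) t) = 0 := by linarith
    exact (mul_eq_zero.1 this).resolve_right hs'
  subst hy hz
  have hT := congrArg (fun v => ⟪T t, v⟫) h
  simp only [zero_smul, add_zero, real_inner_smul_right, F.TT, inner_zero_right, mul_one] at hT
  exact ⟨hT, rfl, rfl⟩

theorem exists_isFoldChart_spread (F : FrenetCurve c T N B κ τ) {a b : ℝ} {α : ℝ → ℝ}
    (hα : IsAngle a b α) (hc : InjOn c (Icc a b)) :
    ∃ ε > 0, IsFoldChart a b ε (spread c α) := by
  refine exists_isFoldChart (fun t ht => (F.contDiffAt_spread hα ht _).of_le (by simp))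
    (fun t ht => ?_) (by simpa only [spread_zero] using hc)
  have hinj : Function.Injective (fderiv ℝ (spread c α) (t, 0, 0)).toLinearMap := by
    rw [injective_iff_map_eq_zero]
    rintro ⟨r, x, y⟩ h
    have h' : fderiv ℝ (spread c α) (t, (0, 0)) (r, (x, y)) = 0 := h
    rw [F.fderiv_spread hα ht] at h'
    simp only [zero_smul, add_zero] at h'
    obtain ⟨rfl, rfl, rfl⟩ := F.linearIndependent_rulings hα ht h'
    rfl
  exact ⟨(LinearEquiv.ofInjectiveOfFinrankEq _ hinj (by simp)).toContinuousLinearEquiv,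
    ContinuousLinearMap.ext fun _ => rfl⟩

/-! ### Geometry of a single strip: flatness, geodesic curvature, embeddedness -/

theorem dv_strip (c : ℝ → E3) (α : ℝ → ℝ) (t v : ℝ) :
    dv (strip c α) t v = ruling c α (secondAngle c α) t := by
  have h : HasDerivAt (fun w : ℝ => strip c α t w)
      ((1 : ℝ) • ruling c α (secondAngle c α) t) v :=
    ((hasDerivAt_id v).smul_const _).const_add _
  rw [dv, h.deriv, one_smul]

theorem dt_strip (F : FrenetCurve c T N B κ τ) {a b : ℝ} {α : ℝ → ℝ}
    (hα : IsAngle a b α) {t : ℝ} (ht : t ∈ Icc a b) (v : ℝ) :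
    dt (strip c α) t v = T t + v • deriv (ruling c α (secondAngle c α)) t := by
  have h1 := ((F.contDiffAt_ruling hα ht).differentiableAt (by simp)).hasDerivAt
  exact ((F.hasDerivAt_curve t).add (h1.const_smul v)).deriv

/-- As ξ' is a combination of T and ξ, the direction of f_t × f_v does not change along a ruling.
Hence f_tv has no normal component, and f_vv = 0. -/
theorem gaussCurvature_strip (F : FrenetCurve c T N B κ τ) {a b : ℝ} {α : ℝ → ℝ}
    (hα : IsAngle a b α) {t : ℝ} (ht : t ∈ Icc a b) (v : ℝ) :
    gaussCurvature (strip c α) t v = 0 := by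
  obtain ⟨p, q, hpq⟩ := F.exists_hasDerivAt_ruling hα ht
  have hvv : dv (dv (strip c α)) t v = 0 := by
    rw [dv, funext (dv_strip c α t), deriv_const]
  have htv : dt (dv (strip c α)) t v = p • T t + q • ruling c α (secondAngle c α) t := by
    rw [dt, funext (fun s => dv_strip c α s v)]; exact hpq.deriv
  have hcr : cross (dt (strip c α) t v) (dv (strip c α) t v) =
      (1 + v * p) • cross (T t) (ruling c α (secondAngle c α) t) := by
    rw [dv_strip, F.dt_strip hα ht, hpq.deriv, ← cross_add_smul_left _ _ _ (v * q)]
    congr 1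
    module
  have hM : ⟪dt (dv (strip c α)) t v, unitNormal (strip c α) t v⟫ = 0 := by
    rw [unitNormal, hcr, htv]
    simp only [inner_add_left, real_inner_smul_left, real_inner_smul_right, inner_cross_left,
      inner_cross_right]
    ring
  rw [gaussCurvature, hM, hvv, inner_zero_left]
  simp

/-- At v = 0 the co-normal is cos α N + sin α B whatever β is, because sin β > 0 drops out on
normalisation. -/
theorem geodesicCurvature_strip (F : FrenetCurve c T N B κ τ) (α : ℝ → ℝ) (t : ℝ) :
    geodesicCurvature (strip c α) t = κ t * Real.cos (α t) := by
  have hs := sin_secondAngle_pos c α t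
  have hdt : (fun s => dt (strip c α) s 0) = T := by
    funext s
    have : (fun r => strip c α r 0) = c := by funext r; simp [strip]
    rw [dt, this, (F.hasDerivAt_curve s).deriv]
  have hdt' : dt (strip c α) t 0 = T t := congrFun hdt t
  have hdd : dt (dt (strip c α)) t 0 = κ t • N t := by
    rw [dt, hdt, (F.hasDerivAt_T t).deriv]
  set m := Real.cos (α t) • N t + Real.sin (α t) • B t with hm
  have hTm : ⟪T t, m⟫ = 0 := by
    simp [hm, inner_add_right, real_inner_smul_right, F.TN, F.TB]
  have hmm : ⟪m, m⟫ = 1 := by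
    simp only [hm, inner_add_right, inner_add_left, real_inner_smul_left, real_inner_smul_right,
      F.NN, F.BB, F.NB, real_inner_comm (N t) (B t)]
    linear_combination Real.sin_sq_add_cos_sq (α t)
  have hcr : cross (dt (strip c α) t 0) (dv (strip c α) t 0) =
      Real.sin (secondAngle c α t) • cross (T t) m := by
    rw [hdt', dv_strip, F.ruling_eq, cross_add_smul_right]
  have hn : ‖cross (T t) m‖ = 1 := by
    rw [norm_eq_sqrt_real_inner, inner_cross_cross, F.TT, hmm, hTm]; simp
  have hν : unitNormal (strip c α) t 0 = cross (T t) m := by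
    rw [unitNormal, hcr, norm_smul, hn, mul_one, Real.norm_eq_abs, abs_of_pos hs, smul_smul,
      inv_mul_cancel₀ hs.ne', one_smul]
  rw [geodesicCurvature, hdd, hν, hdt', cross_cross, F.TT, hTm, hm]
  simp only [one_smul, zero_smul, sub_zero, inner_add_right, real_inner_smul_left,
    real_inner_smul_right, F.NN, F.NB]
  ring

theorem isDevelopableStrip (F : FrenetCurve c T N B κ τ) {a b ε : ℝ} {α : ℝ → ℝ}
    (hα : IsAngle a b α) (hΨ : IsFoldChart a b ε (spread c α)) :
    IsDevelopableStrip a b ε c α (strip c α) where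
  smooth_alpha t ht := (hα.contDiffAt t ht).contDiffWithinAt
  alpha_pos := hα.pos
  alpha_lt := hα.lt
  ruled := ⟨secondAngle c α, fun t ht => (F.contDiffAt_secondAngle hα ht).contDiffWithinAt,
    fun t _ => ⟨secondAngle_pos c α t, secondAngle_lt_pi c α t⟩, fun _ _ _ _ => rfl⟩
  regular t ht v hv := by
    have hz : (t, (v, (0 : ℝ))) ∈ Icc a b ×ˢ Icc (-ε) ε ×ˢ Icc (-ε) ε :=
      ⟨ht, Ioo_subset_Icc_self hv, by constructor <;> linarith [hv.1, hv.2]⟩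
    obtain ⟨A, hA⟩ := hΨ.invertible _ hz
    -- The partial derivatives of the strip are those of `spread` on the slice y = 0, so a relation
    -- between them lies in the trivial kernel of the chart's derivative.
    have hker : ∀ p q : ℝ, p • dt (strip c α) t v + q • dv (strip c α) t v = 0 →
        (p, (q, (0 : ℝ))) = (0 : ℝ × ℝ × ℝ) := by
      intro p q h
      apply A.injective
      rw [map_zero, ← h, ← ContinuousLinearEquiv.coe_coe, hA, F.fderiv_spread hα ht,
        F.dt_strip hα ht, dv_strip]
      simp
    refine cross_ne_zero (fun p q h => (Prod.mk.inj (hker p q h)).1) fun h0 => ?_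
    have := hker 0 1 (by rw [h0]; simp)
    simp at this
  embedding := by
    have hg : IsEmbedding (fun p : (Icc a b ×ˢ Ioo (-ε) ε : Set (ℝ × ℝ)) =>
        (⟨(p.1.1, (p.1.2, 0)), p.2.1, Ioo_subset_Icc_self p.2.2, by
          constructor <;> linarith [p.2.2.1, p.2.2.2]⟩ :
          (Icc a b ×ˢ Icc (-ε) ε ×ˢ Icc (-ε) ε : Set (ℝ × ℝ × ℝ)))) := by
      have hi : IsEmbedding (fun w : ℝ × ℝ => (w.1, (w.2, (0 : ℝ)))) :=
        IsEmbedding.of_leftInverse (f := fun z : ℝ × ℝ × ℝ => (z.1, z.2.1)) (fun _ => rfl)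
          (by fun_prop) (by fun_prop)
      exact IsEmbedding.of_comp (by fun_prop) continuous_subtype_val
        (hi.comp IsEmbedding.subtypeVal)
    have he := hΨ.isEmbedding.comp hg
    have hfun : (fun p : (Icc a b ×ˢ Ioo (-ε) ε : Set (ℝ × ℝ)) => strip c α p.1.1 p.1.2) =
        fun p => spread c α (p.1.1, p.1.2, 0) := funext fun p => strip_eq_spread c α _ _
    rw [hfun]
    exact he
  flat t ht v _ := F.gaussCurvature_strip hα ht v

end FrenetCurve

theorem hasDerivAt_euclidean {ι : Type*} [Fintype ι] {f : ℝ → EuclideanSpace ℝ ι}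
    {f' : EuclideanSpace ℝ ι} {t : ℝ} (h : ∀ i, HasDerivAt (fun s => f s i) (f' i) t) :
    HasDerivAt f f' t := by
  have h1 : HasDerivAt (fun s => (f s).ofLp) f'.ofLp t := hasDerivAt_pi.2 h
  exact (PiLp.continuousLinearEquiv 2 ℝ (fun _ : ι => ℝ)).symm.hasFDerivAt.comp_hasDerivAt t h1

/-! ### The Frenet frame of `c₀` -/

noncomputable section

/-- Unit tangent of `c₀`. -/
def T₀ (t : ℝ) : E3 := !₂[1 / (1 + t ^ 2), √2 * t / (1 + t ^ 2), t ^ 2 / (1 + t ^ 2)]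

/-- Unit principal normal of `c₀`. -/
def N₀ (t : ℝ) : E3 :=
  !₂[-(√2 * t) / (1 + t ^ 2), (1 - t ^ 2) / (1 + t ^ 2), √2 * t / (1 + t ^ 2)]

/-- Unit binormal of `c₀`. -/
def B₀ (t : ℝ) : E3 := !₂[t ^ 2 / (1 + t ^ 2), -(√2 * t) / (1 + t ^ 2), 1 / (1 + t ^ 2)]

/-- Curvature and torsion of `c₀`. -/
def κ₀ (t : ℝ) : ℝ := √2 / (1 + t ^ 2)

end

theorem one_add_sq_pos (t : ℝ) : 0 < 1 + t ^ 2 := by positivity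

theorem hasDerivAt_div_one_add_sq {g : ℝ → ℝ} {g' t : ℝ} (h : HasDerivAt g g' t) :
    HasDerivAt (fun s => g s / (1 + s ^ 2)) ((g' * (1 + t ^ 2) - g t * (2 * t)) / (1 + t ^ 2) ^ 2)
      t := by
  have h1 : HasDerivAt (fun s : ℝ => 1 + s ^ 2) (2 * t) t := by
    simpa using (hasDerivAt_pow 2 t).const_add 1
  exact h.div h1 (one_add_sq_pos t).ne'

theorem contDiff_div_one_add_sq {g : ℝ → ℝ} (h : ContDiff ℝ ∞ g) :
    ContDiff ℝ ∞ (fun s => g s / (1 + s ^ 2)) :=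
  h.div (by fun_prop) fun t => (one_add_sq_pos t).ne'

theorem contDiff_T₀ : ContDiff ℝ ∞ T₀ := by
  rw [contDiff_euclidean]
  intro i
  fin_cases i
  · exact contDiff_div_one_add_sq contDiff_const
  · exact contDiff_div_one_add_sq (by fun_prop : ContDiff ℝ ∞ fun t : ℝ => √2 * t)
  · exact contDiff_div_one_add_sq (by fun_prop : ContDiff ℝ ∞ fun t : ℝ => t ^ 2)

theorem contDiff_N₀ : ContDiff ℝ ∞ N₀ := by
  rw [contDiff_euclidean]
  intro i
  fin_cases i
  · exact contDiff_div_one_add_sq (by fun_prop : ContDiff ℝ ∞ fun t : ℝ => -(√2 * t))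
  · exact contDiff_div_one_add_sq (by fun_prop : ContDiff ℝ ∞ fun t : ℝ => 1 - t ^ 2)
  · exact contDiff_div_one_add_sq (by fun_prop : ContDiff ℝ ∞ fun t : ℝ => √2 * t)

theorem contDiff_B₀ : ContDiff ℝ ∞ B₀ := by
  rw [contDiff_euclidean]
  intro i
  fin_cases i
  · exact contDiff_div_one_add_sq (by fun_prop : ContDiff ℝ ∞ fun t : ℝ => t ^ 2)
  · exact contDiff_div_one_add_sq (by fun_prop : ContDiff ℝ ∞ fun t : ℝ => -(√2 * t))
  · exact contDiff_div_one_add_sq contDiff_const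

theorem contDiff_c₀ : ContDiff ℝ ∞ c₀ := by
  rw [contDiff_euclidean]
  intro i
  have h1 : ContDiff ℝ ∞ (fun t : ℝ => 1 + t ^ 2) := by fun_prop
  fin_cases i
  · exact Real.contDiff_arctan
  · exact (h1.log fun t => (one_add_sq_pos t).ne').div_const _
  · exact contDiff_id.sub Real.contDiff_arctan

theorem contDiff_κ₀ : ContDiff ℝ ∞ κ₀ := contDiff_div_one_add_sq contDiff_const

theorem hasDerivAt_c₀ (t : ℝ) : HasDerivAt c₀ (T₀ t) t := by
  have h1 : HasDerivAt (fun s : ℝ => 1 + s ^ 2) (2 * t) t := by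
    simpa using (hasDerivAt_pow 2 t).const_add 1
  have h2 := (one_add_sq_pos t).ne'
  have hs : √(2 : ℝ) * √2 = 2 := Real.mul_self_sqrt (by norm_num)
  refine hasDerivAt_euclidean fun i => ?_
  fin_cases i
  · exact Real.hasDerivAt_arctan t
  · refine ((h1.log h2).div_const (√2)).congr_deriv ?_
    simp only [T₀, Fin.mk_one, PiLp.toLp_apply, Matrix.cons_val_one, Matrix.cons_val_zero]
    field_simp
    linear_combination -t * hs
  · refine ((hasDerivAt_id t).sub (Real.hasDerivAt_arctan t)).congr_deriv ?_
    simp [T₀]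
    field_simp
    ring

theorem hasDerivAt_T₀ (t : ℝ) : HasDerivAt T₀ (κ₀ t • N₀ t) t := by
  have h2 := (one_add_sq_pos t).ne'
  have hs : √(2 : ℝ) * √2 = 2 := Real.mul_self_sqrt (by norm_num)
  refine hasDerivAt_euclidean fun i => ?_
  fin_cases i
  · refine (hasDerivAt_div_one_add_sq (hasDerivAt_const t 1)).congr_deriv ?_
    simp [N₀, κ₀]
    field_simp
    linear_combination t * hs
  · refine (hasDerivAt_div_one_add_sq ((hasDerivAt_id t).const_mul √2)).congr_deriv ?_
    simp [N₀, κ₀]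
    field_simp
    ring
  · refine (hasDerivAt_div_one_add_sq (hasDerivAt_pow 2 t)).congr_deriv ?_
    simp [N₀, κ₀]
    field_simp
    linear_combination -t * hs

theorem hasDerivAt_N₀ (t : ℝ) : HasDerivAt N₀ (-κ₀ t • T₀ t + κ₀ t • B₀ t) t := by
  have h2 := (one_add_sq_pos t).ne'
  have hs : √(2 : ℝ) * √2 = 2 := Real.mul_self_sqrt (by norm_num)
  refine hasDerivAt_euclidean fun i => ?_
  fin_cases i
  · refine (hasDerivAt_div_one_add_sq ((hasDerivAt_id t).const_mul √2).neg).congr_deriv ?_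
    simp [T₀, B₀, κ₀]
    field_simp
    ring
  · refine (hasDerivAt_div_one_add_sq ((hasDerivAt_pow 2 t).const_sub 1)).congr_deriv ?_
    simp [T₀, B₀, κ₀]
    field_simp
    linear_combination 2 * t * hs
  · refine (hasDerivAt_div_one_add_sq ((hasDerivAt_id t).const_mul √2)).congr_deriv ?_
    simp [T₀, B₀, κ₀]
    field_simp
    ring

theorem hasDerivAt_B₀ (t : ℝ) : HasDerivAt B₀ (-κ₀ t • N₀ t) t := by
  have h2 := (one_add_sq_pos t).ne'
  have hs : √(2 : ℝ) * √2 = 2 := Real.mul_self_sqrt (by norm_num)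
  refine hasDerivAt_euclidean fun i => ?_
  fin_cases i
  · refine (hasDerivAt_div_one_add_sq (hasDerivAt_pow 2 t)).congr_deriv ?_
    simp [N₀, κ₀]
    field_simp
    linear_combination -t * hs
  · refine (hasDerivAt_div_one_add_sq ((hasDerivAt_id t).const_mul √2).neg).congr_deriv ?_
    simp [N₀, κ₀]
    field_simp
    ring
  · refine (hasDerivAt_div_one_add_sq (hasDerivAt_const t 1)).congr_deriv ?_
    simp [N₀, κ₀]
    field_simp
    linear_combination t * hs

theorem frenetCurve_c₀ : FrenetCurve c₀ T₀ N₀ B₀ κ₀ κ₀ := by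
  have hs : √(2 : ℝ) ^ 2 = 2 := Real.sq_sqrt (by norm_num)
  refine ⟨contDiff_c₀, contDiff_T₀, contDiff_N₀, contDiff_B₀, contDiff_κ₀, contDiff_κ₀,
    hasDerivAt_c₀, hasDerivAt_T₀, hasDerivAt_N₀, hasDerivAt_B₀, fun t => ?_, fun t => ?_,
    fun t => ?_, fun t => ?_, fun t => ?_, fun t => ?_, fun t => ?_, fun t => ?_⟩
  all_goals have h2 := (one_add_sq_pos t).ne'
  · simp only [inner_eq_sum]; simp [T₀]; field_simp; linear_combination t ^ 2 * hs
  · simp only [inner_eq_sum]; simp [N₀]; field_simp; linear_combination 2 * t ^ 2 * hs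
  · simp only [inner_eq_sum]; simp [B₀]; field_simp; linear_combination t ^ 2 * hs
  · simp only [inner_eq_sum]; simp [T₀, N₀]; field_simp; ring
  · simp only [inner_eq_sum]; simp [T₀, B₀]; field_simp; linear_combination -t ^ 2 * hs
  · simp only [inner_eq_sum]; simp [N₀, B₀]; field_simp; ring
  · apply ext_E3 <;> simp only [cross_apply_zero, cross_apply_one, cross_apply_two] <;>
      simp [T₀, N₀, B₀] <;> field_simp
    · linear_combination t ^ 2 * hs
    · ring
    · linear_combination t ^ 2 * hs
  · exact div_pos (by positivity) (one_add_sq_pos t)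

/-- Reversal flips T and B and keeps N, κ and τ. The flip of B is why an angle of the reversed curve
changes sign in the frame of the original one. -/
theorem FrenetCurve.reversed {c T N B : ℝ → E3} {κ τ : ℝ → ℝ} (F : FrenetCurve c T N B κ τ)
    (a b : ℝ) : FrenetCurve (reversed a b c) (fun t => -T (-t + a + b)) (fun t => N (-t + a + b))
      (fun t => -B (-t + a + b)) (fun t => κ (-t + a + b)) (fun t => τ (-t + a + b)) := by
  have hr : ContDiff ℝ ∞ (fun t : ℝ => -t + a + b) := by fun_prop
  have hd : ∀ t, HasDerivAt (fun t : ℝ => -t + a + b) (-1) t := fun t =>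
    ((hasDerivAt_neg t).add_const a).add_const b
  refine ⟨F.contDiff_curve.comp hr, (F.contDiff_T.comp hr).neg, F.contDiff_N.comp hr,
    (F.contDiff_B.comp hr).neg, F.contDiff_κ.comp hr, F.contDiff_τ.comp hr,
    fun t => ?_, fun t => ?_, fun t => ?_, fun t => ?_, fun t => ?_, fun t => ?_,
    fun t => ?_, fun t => ?_, fun t => ?_, fun t => ?_, fun t => ?_, fun t => F.κ_pos _⟩
  · exact ((F.hasDerivAt_curve _).scomp t (hd t)).congr_deriv (by module)
  · exact ((F.hasDerivAt_T _).scomp t (hd t)).neg.congr_deriv (by module)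
  · exact ((F.hasDerivAt_N _).scomp t (hd t)).congr_deriv (by module)
  · exact ((F.hasDerivAt_B _).scomp t (hd t)).neg.congr_deriv (by module)
  · simpa using F.TT _
  · simpa using F.NN _
  · simpa using F.BB _
  · simpa using F.TN _
  · simpa using F.TB _
  · simpa using F.NB _
  · rw [← F.cross_eq, ← neg_one_smul ℝ (T _), cross_smul_left, neg_one_smul]

/-! ### The first angular functions -/

theorem contDiff_α₀ : ContDiff ℝ ∞ α₀ :=
  (contDiff_const.mul (contDiff_id.add contDiff_const)).div_const _

theorem pi_div_three_lt_α₀ {t : ℝ} (ht : t ∈ I₀) : Real.pi / 3 < α₀ t := by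
  have := Real.pi_pos
  rw [α₀]; nlinarith [ht.1]

theorem α₀_lt {t : ℝ} (ht : t ∈ I₀) : α₀ t < Real.pi / 2 := by
  have := Real.pi_pos
  rw [α₀]; nlinarith [ht.2]

theorem isAngle_α₀ : IsAngle (1 / 10) (9 / 10) α₀ := by
  have h : ∀ t ∈ Icc (1 / 10 : ℝ) (9 / 10), 0 < α₀ t := fun t ht => by
    linarith [pi_div_three_lt_α₀ ht, Real.pi_pos]
  refine ⟨fun t _ => contDiff_α₀.contDiffAt, fun t ht => abs_pos.2 (h t ht).ne', fun t ht => ?_⟩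
  rw [abs_of_pos (h t ht)]; exact α₀_lt ht

theorem cos_α₀_pos {t : ℝ} (ht : t ∈ I₀) : 0 < Real.cos (α₀ t) := isAngle_α₀.cos_pos ht

theorem cos_α₀_lt {t : ℝ} (ht : t ∈ I₀) : Real.cos (α₀ t) < 1 / 2 := by
  rw [← Real.cos_pi_div_three]
  exact Real.cos_lt_cos_of_nonneg_of_le_pi_div_two (by positivity) (α₀_lt ht).le
    (pi_div_three_lt_α₀ ht)

theorem μ₀_eq (t : ℝ) : μ₀ t = κ₀ t * Real.cos (α₀ t) := by
  rw [μ₀, frenetCurve_c₀.curvature_eq]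

theorem μ₀_pos {t : ℝ} (ht : t ∈ I₀) : 0 < μ₀ t := by
  rw [μ₀_eq]; exact mul_pos (frenetCurve_c₀.κ_pos t) (cos_α₀_pos ht)

theorem κ₀_lt_κ₀ {s t : ℝ} (hs : 0 ≤ s) (h : s < t) : κ₀ t < κ₀ s :=
  div_lt_div_of_pos_left (by positivity) (one_add_sq_pos s) (by nlinarith)

/-- The number √2 / 2 separates the two: κ ≤ √2 and cos α < 1/2 bound μ from above, while t < 1
bounds κ from below. -/
theorem μ₀_lt_κ₀ {s t : ℝ} (hs : s ∈ I₀) (ht : t ∈ I₀) : μ₀ s < κ₀ t := by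
  have h0 : 0 < √(2 : ℝ) := by positivity
  have h1 : κ₀ s ≤ √2 := by
    rw [κ₀, div_le_iff₀ (one_add_sq_pos s)]; nlinarith [sq_nonneg s]
  have h2 : √2 / 2 < κ₀ t := by
    rw [κ₀]
    exact div_lt_div_of_pos_left h0 (one_add_sq_pos t) (by nlinarith [ht.1, ht.2])
  rw [μ₀_eq]
  have := cos_α₀_lt hs
  have := cos_α₀_pos hs
  nlinarith

/-- Both positive factors κ and cos α decrease. This monotonicity later separates the strip from its
inverse. -/
theorem μ₀_lt_μ₀ {s t : ℝ} (hs : s ∈ I₀) (ht : t ∈ I₀) (h : s < t) : μ₀ t < μ₀ s := by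
  rw [μ₀_eq, μ₀_eq]
  have hs0 : 0 ≤ s := by linarith [hs.1]
  refine mul_lt_mul (κ₀_lt_κ₀ hs0 h) ?_ (cos_α₀_pos ht) (frenetCurve_c₀.κ_pos s).le
  refine Real.cos_le_cos_of_nonneg_of_le_pi (by linarith [pi_div_three_lt_α₀ hs, Real.pi_pos])
    (by linarith [α₀_lt ht, Real.pi_pos]) ?_
  rw [α₀, α₀]; have := Real.pi_pos; nlinarith

theorem flip_mem {t : ℝ} (ht : t ∈ I₀) : -t + 1 / 10 + 9 / 10 ∈ I₀ := by
  constructor <;> linarith [ht.1, ht.2]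

theorem inverseAngle_eq (t : ℝ) : inverseAngle (1 / 10) (9 / 10) c₀ α₀ t =
    Real.arccos (μ₀ t / κ₀ (-t + 1 / 10 + 9 / 10)) := by
  rw [inverseAngle, μ₀, (frenetCurve_c₀.reversed _ _).curvature_eq]

theorem inverse_ratio_pos {t : ℝ} (ht : t ∈ I₀) : 0 < μ₀ t / κ₀ (-t + 1 / 10 + 9 / 10) :=
  div_pos (μ₀_pos ht) (frenetCurve_c₀.κ_pos _)

theorem inverse_ratio_lt_one {t : ℝ} (ht : t ∈ I₀) : μ₀ t / κ₀ (-t + 1 / 10 + 9 / 10) < 1 :=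
  (div_lt_one (frenetCurve_c₀.κ_pos _)).2 (μ₀_lt_κ₀ ht (flip_mem ht))

theorem cos_inverseAngle {t : ℝ} (ht : t ∈ I₀) :
    Real.cos (inverseAngle (1 / 10) (9 / 10) c₀ α₀ t) = μ₀ t / κ₀ (-t + 1 / 10 + 9 / 10) := by
  rw [inverseAngle_eq, Real.cos_arccos (by linarith [inverse_ratio_pos ht])
    (inverse_ratio_lt_one ht).le]

theorem contDiff_μ₀ : ContDiff ℝ ∞ μ₀ := by
  rw [funext μ₀_eq]; exact contDiff_κ₀.mul contDiff_α₀.cos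

theorem inverseAngle_pos {t : ℝ} (ht : t ∈ I₀) :
    0 < inverseAngle (1 / 10) (9 / 10) c₀ α₀ t := by
  rw [inverseAngle_eq]; exact Real.arccos_pos.2 (inverse_ratio_lt_one ht)

theorem inverseAngle_lt {t : ℝ} (ht : t ∈ I₀) :
    inverseAngle (1 / 10) (9 / 10) c₀ α₀ t < Real.pi / 2 := by
  rw [inverseAngle_eq]; exact Real.arccos_lt_pi_div_two.2 (inverse_ratio_pos ht)

/-- Smoothness rests on the ratio under `Real.arccos` staying strictly between 0 and 1, away from
the singular values ±1. -/
theorem isAngle_inverseAngle :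
    IsAngle (1 / 10) (9 / 10) (inverseAngle (1 / 10) (9 / 10) c₀ α₀) := by
  refine ⟨fun t ht => ?_, fun t ht => abs_pos.2 (inverseAngle_pos ht).ne', fun t ht => ?_⟩
  · rw [funext inverseAngle_eq]
    have hf : ContDiffAt ℝ ∞ (fun t : ℝ => μ₀ t / κ₀ (-t + 1 / 10 + 9 / 10)) t :=
      contDiff_μ₀.contDiffAt.div (contDiff_κ₀.comp (by fun_prop :
        ContDiff ℝ ∞ fun t : ℝ => -t + 1 / 10 + 9 / 10)).contDiffAt (frenetCurve_c₀.κ_pos _).ne'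
    exact ContDiffAt.comp (g := Real.arccos) t (Real.contDiffAt_arccos ((by norm_num : (-1 : ℝ) < 0).trans
      (inverse_ratio_pos ht)).ne' (inverse_ratio_lt_one ht).ne) hf
  · rw [abs_of_pos (inverseAngle_pos ht)]; exact inverseAngle_lt ht

theorem injective_c₀ : Function.Injective c₀ := fun _ _ h =>
  Real.arctan_injective (congrFun (congrArg WithLp.ofLp h) 0)

/-! ### The crease pattern -/

theorem hasDerivAt_integral {g : ℝ → ℝ} (hg : Continuous g) (a t : ℝ) :
    HasDerivAt (fun t => ∫ s in a..t, g s) (g t) t :=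
  intervalIntegral.integral_hasDerivAt_right (hg.intervalIntegrable _ _)
    (hg.stronglyMeasurableAtFilter _ _) hg.continuousAt

theorem contDiff_integral {g : ℝ → ℝ} (hg : ContDiff ℝ ∞ g) (a : ℝ) :
    ContDiff ℝ ∞ (fun t => ∫ s in a..t, g s) := by
  have h := hasDerivAt_integral hg.continuous a
  rw [contDiff_infty_iff_deriv, funext fun t => (h t).deriv]
  exact ⟨fun t => (h t).differentiableAt, hg⟩

/-- A short arc of a plane curve with prescribed nonnegative curvature function. -/
theorem exists_planeCurve {μ : ℝ → ℝ} (hμ : ContDiff ℝ ∞ μ) {a b : ℝ}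
    (hpos : ∀ t ∈ Icc a b, 0 ≤ ∫ s in a..t, μ s)
    (hlen : ∀ t ∈ Icc a b, ∫ s in a..t, μ s < Real.pi / 2) :
    ∃ γ : ℝ → E2, ContDiff ℝ ∞ γ ∧ InjOn γ (Icc a b) ∧
      ∀ t, ‖deriv γ t‖ = 1 ∧ planeCurvature γ t = μ t := by
  set θ : ℝ → ℝ := fun t => ∫ s in a..t, μ s
  have hθ : ContDiff ℝ ∞ θ := contDiff_integral hμ a
  have hdθ : ∀ t, HasDerivAt θ (μ t) t := hasDerivAt_integral hμ.continuous a
  set γ : ℝ → E2 := fun t => !₂[∫ s in a..t, Real.cos (θ s), ∫ s in a..t, Real.sin (θ s)]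
  have hdγ : ∀ t, HasDerivAt γ !₂[Real.cos (θ t), Real.sin (θ t)] t := fun t => by
    refine hasDerivAt_euclidean fun i => ?_
    fin_cases i
    · exact hasDerivAt_integral hθ.cos.continuous a t
    · exact hasDerivAt_integral hθ.sin.continuous a t
  have hγ' : deriv γ = fun t => !₂[Real.cos (θ t), Real.sin (θ t)] :=
    funext fun t => (hdγ t).deriv
  have hddγ : ∀ t, HasDerivAt (deriv γ)
      !₂[-Real.sin (θ t) * μ t, Real.cos (θ t) * μ t] t := fun t => by
    rw [hγ']
    refine hasDerivAt_euclidean fun i => ?_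
    fin_cases i
    · exact (hdθ t).cos
    · exact (hdθ t).sin
  refine ⟨γ, ?_, ?_, fun t => ⟨?_, ?_⟩⟩
  · rw [contDiff_euclidean]
    intro i
    fin_cases i
    · exact contDiff_integral hθ.cos a
    · exact contDiff_integral hθ.sin a
  -- The tangent angle stays in [0, π/2), so the first coordinate increases and the arc is embedded.
  · have hmono : StrictMonoOn (fun t => γ t 0) (Icc a b) := by
      refine strictMonoOn_of_deriv_pos (convex_Icc a b)
        (contDiff_integral hθ.cos a).continuous.continuousOn fun t ht => ?_
      have ht' := interior_subset ht
      have : deriv (fun t => γ t 0) t = Real.cos (θ t) :=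
        (hasDerivAt_integral hθ.cos.continuous a t).deriv
      rw [this]
      exact Real.cos_pos_of_mem_Ioo ⟨by linarith [hpos t ht', Real.pi_pos], hlen t ht'⟩
    exact fun s hs t ht h => hmono.injOn hs ht (congrArg (fun v : E2 => v 0) h)
  · rw [hγ', EuclideanSpace.norm_eq]
    simp
  · rw [planeCurvature, (hddγ t).deriv, hγ']
    simp only [Matrix.cons_val_zero, Matrix.cons_val_one]
    linear_combination μ t * Real.sin_sq_add_cos_sq (θ t)

/-- The total turning is at most √2 · 4/5 < 6/5 < π/2. -/
theorem exists_creasePattern : ∃ γ : ℝ → E2, ContDiff ℝ ∞ γ ∧ InjOn γ I₀ ∧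
    ∀ t, ‖deriv γ t‖ = 1 ∧ planeCurvature γ t = μ₀ t := by
  have hmem : ∀ t ∈ I₀, ∀ s ∈ Icc (1 / 10 : ℝ) t, s ∈ I₀ := fun t ht s hs =>
    ⟨hs.1, hs.2.trans ht.2⟩
  refine exists_planeCurve contDiff_μ₀ (fun t ht => ?_) (fun t ht => ?_)
  · exact intervalIntegral.integral_nonneg ht.1 fun s hs => (μ₀_pos (hmem t ht s hs)).le
  · have h1 : ∫ s in (1 / 10 : ℝ)..t, μ₀ s ≤ ∫ _ in (1 / 10 : ℝ)..t, (√2 : ℝ) := by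
      refine intervalIntegral.integral_mono_on ht.1
        (contDiff_μ₀.continuous.intervalIntegrable _ _) (by simp) fun s hs => ?_
      refine (μ₀_lt_κ₀ (hmem t ht s hs) ht).le.trans ?_
      rw [κ₀, div_le_iff₀ (one_add_sq_pos t)]
      nlinarith [sq_nonneg t, Real.sqrt_nonneg 2]
    have h2 : √(2 : ℝ) < 3 / 2 := by
      rw [Real.sqrt_lt' (by norm_num)]; norm_num
    rw [intervalIntegral.integral_const, smul_eq_mul] at h1
    nlinarith [Real.pi_gt_three, ht.1, ht.2, Real.sqrt_nonneg 2]

/-! ### Curved foldings -/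

/-- The image of `[a, b] × (-δ, δ)` under the origami map of `f^α`. -/
def foldImage (a b : ℝ) (c : ℝ → E3) (α : ℝ → ℝ) (δ : ℝ) : Set E3 :=
  (fun p : ℝ × ℝ => origami c α p.1 p.2) '' (Icc a b ×ˢ Ioo (-δ) δ)

theorem strip_mem_foldImage {a b δ : ℝ} {c : ℝ → E3} {α : ℝ → ℝ} {t v : ℝ} (ht : t ∈ Icc a b)
    (hv : v ∈ Ico 0 δ) : strip c α t v ∈ foldImage a b c α δ :=
  ⟨(t, v), ⟨ht, by linarith [hv.1, hv.2], hv.2⟩, if_pos hv.1⟩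

theorem strip_neg_mem_foldImage {a b δ : ℝ} {c : ℝ → E3} {α : ℝ → ℝ} {t v : ℝ}
    (ht : t ∈ Icc a b) (hv : v ∈ Ioc (-δ) 0) : strip c (-α) t v ∈ foldImage a b c α δ := by
  rcases hv.2.eq_or_lt with rfl | h
  · have : strip c (-α) t 0 = strip c α t 0 := by simp [strip]
    rw [this]
    exact strip_mem_foldImage ht ⟨le_rfl, by linarith [hv.1]⟩
  · exact ⟨(t, v), ⟨ht, hv.1, by linarith [hv.1]⟩, if_neg h.not_ge⟩

theorem curve_mem_foldImage {a b δ : ℝ} (hδ : 0 < δ) {c : ℝ → E3} (α : ℝ → ℝ) {t : ℝ}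
    (ht : t ∈ Icc a b) : c t ∈ foldImage a b c α δ := by
  have : strip c α t 0 = c t := by simp [strip]
  exact this ▸ strip_mem_foldImage ht ⟨le_rfl, hδ⟩

theorem exists_mem_bentSet {a b ε : ℝ} {c : ℝ → E3} {α : ℝ → ℝ} {x : E3}
    (hx : x ∈ foldImage a b c α ε) : ∃ z ∈ bentSet a b ε, spread c α z = x := by
  obtain ⟨⟨t, v⟩, ⟨ht, hv⟩, rfl⟩ := hx
  have hε : 0 < ε := by linarith [hv.1, hv.2]
  have h0 : (0 : ℝ) ∈ Icc (-ε) ε := ⟨by linarith, hε.le⟩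
  by_cases h : 0 ≤ v
  · refine ⟨(t, v, 0), ⟨⟨ht, Ioo_subset_Icc_self hv, h0⟩, h, le_rfl, mul_zero _⟩, ?_⟩
    simp only [origami, if_pos h, strip_eq_spread]
  · refine ⟨(t, 0, v), ⟨⟨ht, h0, Ioo_subset_Icc_self hv⟩, le_rfl, (not_le.1 h).le, zero_mul _⟩, ?_⟩
    simp only [origami, if_neg h, strip_neg_eq_spread]

theorem hasDerivAt_strip (c : ℝ → E3) (α : ℝ → ℝ) (t v : ℝ) :
    HasDerivAt (strip c α t) (ruling c α (secondAngle c α) t) v := by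
  have h : HasDerivAt (strip c α t) ((1 : ℝ) • ruling c α (secondAngle c α) t) v :=
    ((hasDerivAt_id v).smul_const _).const_add _
  rwa [one_smul] at h

theorem exists_linear (T : E3 ≃ᵢ E3) : ∃ L : E3 ≃ₗᵢ[ℝ] E3, ∃ d : E3, ∀ x, T x = L x + d :=
  ⟨T.toRealLinearIsometryEquiv, T 0, fun x => by simp⟩

/-! ### Comparison of two foldings, one mapped into the other -/

section Pair

variable {a b δ ε : ℝ} {c c' T N B T' N' B' : ℝ → E3} {κ τ κ' τ' α α' : ℝ → ℝ}

/-- An isometry that maps one curved folding into another maps crease to crease: at a point of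
the crease the tangent directions span the space, at other points they lie in a plane. -/
theorem exists_crease_eq (F : FrenetCurve c T N B κ τ)
    (hα : IsAngle a b α) (hab : a < b) (hδ : 0 < δ)
    (hΨ' : IsFoldChart a b ε (spread c' α')) {M : E3 → E3} {L : E3 ≃ₗᵢ[ℝ] E3} {d : E3}
    (hM : ∀ x, M x = L x + d) (hsub : M '' foldImage a b c α δ ⊆ foldImage a b c' α' ε)
    {t : ℝ} (ht : t ∈ Icc a b) : ∃ s ∈ Icc a b, M (c t) = c' s := by
  choose! Z hZ using fun x (hx : x ∈ foldImage a b c' α' ε) => exists_mem_bentSet hx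
  have hMd : ∀ {x : ℝ → E3} {w : E3} {S : Set ℝ} {s : ℝ}, HasDerivWithinAt x w S s →
      HasDerivWithinAt (fun r => M (x r)) (L w) S s := by
    intro x w S s hx
    rw [show (fun r => M (x r)) = fun r => L (x r) + d from funext fun r => hM _]
    exact (L.toContinuousLinearEquiv.hasFDerivAt.comp_hasDerivWithinAt s hx).add_const d
  have key : ∀ {x : ℝ → E3} {w : E3} {S : Set ℝ} {s : ℝ}, s ∈ S → UniqueDiffWithinAt ℝ S s →
      (∀ r ∈ S, x r ∈ foldImage a b c α δ) → x s = c t → HasDerivWithinAt x w S s →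
      ∃ k, fderiv ℝ (spread c' α') (Z (M (c t))) k = L w ∧
        k.2.1 * (Z (M (c t))).2.2 + (Z (M (c t))).2.1 * k.2.2 = 0 := by
    intro x w S s hs hS hx hxs hd
    have hz : ∀ r ∈ S, Z (M (x r)) ∈ bentSet a b ε ∧ spread c' α' (Z (M (x r))) = M (x r) :=
      fun r hr => hZ _ (hsub (mem_image_of_mem M (hx r hr)))
    obtain ⟨k, hk, hkd⟩ := hΨ'.hasDerivWithinAt_lift (z := fun r => Z (M (x r))) hs
      (fun r hr => (hz r hr).1.1) (fun r hr => (hz r hr).2) (hMd hd)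
    have h0 := mul_add_mul_eq_zero_of_mem_bentSet hs hS (fun r hr => (hz r hr).1) hkd
    simp only [hxs] at hk h0
    exact ⟨k, hk, h0⟩
  -- Three test curves through the crease point: the crease and one ruling in each half. At ends of
  -- their domains only one-sided derivatives are available.
  obtain ⟨k₁, hk₁, h₁⟩ := key (x := c) ht (uniqueDiffOn_Icc hab t ht)
    (fun r hr => curve_mem_foldImage hδ α hr) rfl (F.hasDerivAt_curve t).hasDerivWithinAt
  obtain ⟨k₂, hk₂, h₂⟩ := key (x := strip c α t) (S := Ico 0 δ) (s := 0) ⟨le_rfl, hδ⟩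
    (uniqueDiffOn_Ico 0 δ 0 ⟨le_rfl, hδ⟩)
    (fun r hr => strip_mem_foldImage ht hr) (by simp [strip])
    (hasDerivAt_strip c α t 0).hasDerivWithinAt
  obtain ⟨k₃, hk₃, h₃⟩ := key (x := strip c (-α) t) (S := Ioc (-δ) 0) (s := 0)
    ⟨by linarith, le_rfl⟩ (uniqueDiffOn_Ioc (-δ) 0 0 ⟨by linarith, le_rfl⟩)
    (fun r hr => strip_neg_mem_foldImage ht hr) (by simp [strip])
    (hasDerivAt_strip c (-α) t 0).hasDerivWithinAt
  obtain ⟨hz, hzx⟩ := hZ _ (hsub (mem_image_of_mem M (curve_mem_foldImage hδ α ht)))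
  obtain ⟨A, hA⟩ := hΨ'.invertible _ hz.1
  set z := Z (M (c t))
  rw [← hA] at hk₁ hk₂ hk₃
  simp only [ContinuousLinearEquiv.coe_coe] at hk₁ hk₂ hk₃
  -- The three velocities are independent, and so are their images under `L` and the lifts of these.
  -- Hence the linear condition holds for every k, which forces both of its coefficients to vanish.
  have hsurj : Function.Surjective (fun r : ℝ × ℝ × ℝ => r.1 • k₁ + r.2.1 • k₂ + r.2.2 • k₃) := by
    let G : (ℝ × ℝ × ℝ) →ₗ[ℝ] (ℝ × ℝ × ℝ) :=
      { toFun := fun r => r.1 • k₁ + r.2.1 • k₂ + r.2.2 • k₃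
        map_add' := fun r s => by simp only [Prod.fst_add, Prod.snd_add]; module
        map_smul' := fun m r => by
          simp only [Prod.smul_fst, Prod.smul_snd, smul_eq_mul, RingHom.id_apply]; module }
    have hG : Function.Injective G := by
      rw [injective_iff_map_eq_zero]
      rintro ⟨r, x, y⟩ h
      have h' : r • k₁ + x • k₂ + y • k₃ = 0 := h
      have h'' := congrArg A h'
      simp only [map_add, map_smul, hk₁, hk₂, hk₃, map_zero] at h''
      rw [← map_smul, ← map_smul, ← map_smul, ← map_add, ← map_add] at h''
      obtain ⟨rfl, rfl, rfl⟩ := F.linearIndependent_rulings hα ht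
        (L.injective (h''.trans (map_zero L).symm))
      rfl
    exact LinearMap.injective_iff_surjective.1 hG
  have hlin : ∀ k : ℝ × ℝ × ℝ, k.2.1 * z.2.2 + z.2.1 * k.2.2 = 0 := by
    intro k
    obtain ⟨r, rfl⟩ := hsurj k
    simp only [Prod.snd_add, Prod.fst_add, Prod.smul_snd, Prod.smul_fst, smul_eq_mul]
    linear_combination r.1 * h₁ + r.2.1 * h₂ + r.2.2 * h₃
  have hX : z.2.1 = 0 := by simpa using hlin (0, 0, 1)
  have hY : z.2.2 = 0 := by simpa using hlin (0, 1, 0)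
  refine ⟨z.1, hz.1.1, ?_⟩
  rw [← hzx, ← spread_zero c' α' z.1]
  congr 1
  exact Prod.ext rfl (Prod.ext hX hY)

/-- The tangent half planes of a curved folding at its crease. -/
theorem exists_ruling_eq (F' : FrenetCurve c' T' N' B' κ' τ') (hα' : IsAngle a b α')
    (hδ : 0 < δ) (hΨ' : IsFoldChart a b ε (spread c' α'))
    (hsub : foldImage a b c α δ ⊆ foldImage a b c' α' ε) {s t : ℝ} (hs : s ∈ Icc a b)
    (ht : t ∈ Icc a b) (hst : c t = c' s) :
    ∃ r x y : ℝ, 0 ≤ x ∧ y ≤ 0 ∧ x * y = 0 ∧ ruling c α (secondAngle c α) t =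
      r • T' s + x • ruling c' α' (secondAngle c' α') s +
        y • ruling c' (-α') (secondAngle c' (-α')) s := by
  choose! Z hZ using fun x (hx : x ∈ foldImage a b c' α' ε) => exists_mem_bentSet hx
  have hz : ∀ v ∈ Ico 0 δ, Z (strip c α t v) ∈ bentSet a b ε ∧
      spread c' α' (Z (strip c α t v)) = strip c α t v :=
    fun v hv => hZ _ (hsub (strip_mem_foldImage ht hv))
  have h0 : (0 : ℝ) ∈ Ico 0 δ := ⟨le_rfl, hδ⟩
  obtain ⟨k, hk, hkd⟩ := hΨ'.hasDerivWithinAt_lift (z := fun v => Z (strip c α t v)) h0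
    (fun v hv => (hz v hv).1.1) (fun v hv => (hz v hv).2)
    (hasDerivAt_strip c α t 0).hasDerivWithinAt
  obtain ⟨hz0, hz0'⟩ := hz 0 h0
  have hε : 0 ≤ ε := by linarith [hz0.1.2.1.1, hz0.1.2.1.2]
  have hε0 : (0 : ℝ) ∈ Icc (-ε) ε := ⟨by linarith, hε⟩
  -- Injectivity of the chart forces the chosen lift to start at the known crease point.
  have hZ0 : Z (strip c α t 0) = (s, 0, 0) := by
    refine hΨ'.injOn hz0.1 ⟨hs, hε0, hε0⟩ ?_
    rw [hz0', spread_zero, ← hst]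
    simp [strip]
  obtain ⟨hx, hy, hxy⟩ := deriv_mem_of_mem_bentSet hδ (fun v hv => (hz v hv).1)
    (by simp only [hZ0]; rfl) hkd
  refine ⟨k.1, k.2.1, k.2.2, hx, hy, hxy, ?_⟩
  simp only [hZ0] at hk
  rw [← hk]
  have := F'.fderiv_spread hα' hs (0, 0) k.2 k.1
  simpa using this

/-- Two nested curved foldings with a common crease point have the same angle between osculating
plane and surface there. -/
theorem angle_eq_of_subset (F : FrenetCurve c T N B κ τ) (F' : FrenetCurve c' T' N' B' κ' τ')
    (hα' : IsAngle a b α') (hδ : 0 < δ) (hΨ' : IsFoldChart a b ε (spread c' α'))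
    (hsub : foldImage a b c α δ ⊆ foldImage a b c' α' ε) {s t : ℝ} (hs : s ∈ Icc a b)
    (hα : IsAngle a b α) (ht : t ∈ Icc a b) (hst : c t = c' s) (hN : N' s = N t) {m : ℝ}
    (hm : m = 1 ∨ m = -1) (hB : B' s = m • B t) :
    Real.cos (α t) = Real.cos (α' s) ∧ Real.sin (α t) = m * Real.sin (α' s) := by
  obtain ⟨r, x, y, hx, hy, hxy, h⟩ := exists_ruling_eq F' hα' hδ hΨ' hsub hs ht hst
  have hmm : m * m = 1 := by rcases hm with rfl | rfl <;> norm_num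
  have hBt : B t = m • B' s := by rw [hB, smul_smul, hmm, one_smul]
  have h1 := congrArg (fun v => ⟪N t, v⟫) h
  have h2 := congrArg (fun v => ⟪B t, v⟫) h
  simp only [F.inner_N_ruling] at h1
  simp only [F.inner_B_ruling] at h2
  rw [← hN] at h1
  rw [hBt] at h2
  simp only [inner_add_right, real_inner_smul_right, real_inner_smul_left, F'.inner_N_ruling,
    F'.inner_B_ruling, real_inner_comm (T' s), F'.TN, F'.TB, Pi.neg_apply, Real.cos_neg,
    Real.sin_neg] at h1 h2
  have hp := sin_secondAngle_pos c α t
  have hp1 := sin_secondAngle_pos c' α' s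
  have hp2 := sin_secondAngle_pos c' (-α') s
  have hcα := hα.cos_pos ht
  have hcα' := hα'.cos_pos hs
  generalize Real.sin (secondAngle c α t) = S at *
  generalize Real.sin (secondAngle c' α' s) = S₁ at *
  generalize Real.sin (secondAngle c' (-α') s) = S₂ at *
  have hsq := Real.sin_sq_add_cos_sq (α t)
  have hsq' := Real.sin_sq_add_cos_sq (α' s)
  generalize Real.cos (α t) = C at *
  generalize Real.cos (α' s) = C' at *
  generalize Real.sin (α t) = D at *
  generalize Real.sin (α' s) = D' at *
  -- All rulings have positive N-component, so the half strip v ≥ 0 cannot match the half with y ≤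
  -- 0.
  have hy0 : y = 0 := by
    rcases mul_eq_zero.1 hxy with h0 | h0
    · exfalso
      subst h0
      have : 0 < S * C := by positivity
      have : y * (S₂ * C') ≤ 0 := mul_nonpos_of_nonpos_of_nonneg hy (by positivity)
      linarith
    · exact h0
  subst hy0
  have e1 : S * C = (x * S₁) * C' := by linarith
  have e2 : S * D = (x * S₁) * (m * D') := by linarith
  have hP : 0 ≤ x * S₁ := by positivity
  -- Both sides are polar coordinates of the projection to the normal plane; the radii agree, so the
  -- angles do.
  have hsqe : S ^ 2 = (x * S₁) ^ 2 := by
    have : S ^ 2 * (D ^ 2 + C ^ 2) = (x * S₁) ^ 2 * (m * m * D' ^ 2 + C' ^ 2) := by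
      linear_combination (S * D + (x * S₁) * (m * D')) * e2 + (S * C + (x * S₁) * C') * e1
    rw [hsq, hmm, one_mul, hsq'] at this
    linarith
  have hSP : S = x * S₁ := by
    rcases sq_eq_sq_iff_eq_or_eq_neg.1 hsqe with h | h
    · exact h
    · linarith
  rw [← hSP] at e1 e2
  exact ⟨mul_left_cancel₀ hp.ne' e1, mul_left_cancel₀ hp.ne' e2⟩

end Pair

/-! ### Rigidity of the crease -/

/-- An isometry that maps the arc `c₀(I₀)` into itself is the identity. -/
theorem eq_id_of_mapsTo_crease {M : E3 → E3} {L : E3 ≃ₗᵢ[ℝ] E3} {d : E3}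
    (hM : ∀ x, M x = L x + d) (h : ∀ t ∈ I₀, ∃ s ∈ I₀, M (c₀ t) = c₀ s) : ∀ x, M x = x := by
  choose! σ hσI hσ using h
  set J : Set ℝ := Ioo (1 / 10) (9 / 10) with hJ
  have hJI : J ⊆ I₀ := Ioo_subset_Icc_self
  have hnhds : ∀ t ∈ J, J ∈ 𝓝 t := fun t ht => isOpen_Ioo.mem_nhds ht
  have hMc : ∀ t, HasDerivAt (fun t => M (c₀ t)) (L (T₀ t)) t := fun t => by
    rw [show (fun t => M (c₀ t)) = fun t => L (c₀ t) + d from funext fun r => hM _]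
    exact (L.toContinuousLinearEquiv.hasFDerivAt.comp_hasDerivAt t (hasDerivAt_c₀ t)).add_const d
  have hLT : ∀ t, HasDerivAt (fun t => L (T₀ t)) (L (κ₀ t • N₀ t)) t := fun t =>
    L.toContinuousLinearEquiv.hasFDerivAt.comp_hasDerivAt t (hasDerivAt_T₀ t)
  -- The first coordinate of `c₀` is arctan, so its tangent recovers the parameter; this makes σ
  -- smooth.
  have hσtan : ∀ t ∈ I₀, σ t = Real.tan (M (c₀ t) 0) := fun t ht => by
    rw [hσ t ht]; exact (Real.tan_arctan _).symm
  have hMsm : ContDiff ℝ ∞ (fun t => M (c₀ t) 0) := by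
    rw [show (fun t => M (c₀ t) 0) = fun t => (L (c₀ t) + d) 0 from funext fun r => by rw [hM]]
    exact contDiff_euclidean.1
      ((L.toContinuousLinearEquiv.contDiff.comp contDiff_c₀).add contDiff_const) 0
  have hσsm : ∀ t ∈ J, ContDiffAt ℝ ∞ σ t := fun t ht => by
    have h1 : ContDiffAt ℝ ∞ (fun t => Real.tan (M (c₀ t) 0)) t := by
      refine ContDiffAt.comp (g := Real.tan) t (Real.contDiffAt_tan.2 ?_) hMsm.contDiffAt
      rw [hσ t (hJI ht)]
      exact (Real.cos_arctan_pos _).ne'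
    refine h1.congr_of_eventuallyEq ?_
    filter_upwards [hnhds t ht] with r hr using hσtan r (hJI hr)
  have hdσ : ∀ t ∈ J, HasDerivAt σ (deriv σ t) t := fun t ht =>
    ((hσsm t ht).differentiableAt (by simp)).hasDerivAt
  have hddσ : ∀ t ∈ J, HasDerivAt (deriv σ) (deriv (deriv σ) t) t := fun t ht =>
    (((hσsm t ht).derivWithin (m := ∞) (by simp)).differentiableAt (by simp)).hasDerivAt
  have hfirst : ∀ t ∈ J, L (T₀ t) = deriv σ t • T₀ (σ t) := fun t ht => by
    refine (hMc t).unique ?_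
    refine (HasDerivAt.scomp t (hasDerivAt_c₀ (σ t)) (hdσ t ht)).congr_of_eventuallyEq ?_
    filter_upwards [hnhds t ht] with r hr using hσ r (hJI hr)
  have hsq : ∀ t ∈ J, deriv σ t ^ 2 = 1 := fun t ht => by
    have h1 := congrArg (fun v => ‖v‖) (hfirst t ht)
    simp only [L.norm_map, norm_smul, frenetCurve_c₀.norm_T, Real.norm_eq_abs, mul_one] at h1
    rw [← sq_abs, ← h1, one_pow]
  -- Differentiating (σ')² = 1 gives σ' σ'' = 0 with σ' ≠ 0.
  have hdd0 : ∀ t ∈ J, deriv (deriv σ) t = 0 := fun t ht => by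
    have h1 := (hddσ t ht).pow 2
    have h2 : HasDerivAt (deriv σ ^ 2) 0 t := by
      refine (hasDerivAt_const t (1 : ℝ)).congr_of_eventuallyEq ?_
      filter_upwards [hnhds t ht] with r hr using hsq r hr
    have h3 := h1.unique h2
    have h4 : deriv σ t ≠ 0 := fun h0 => by have := hsq t ht; rw [h0] at this; norm_num at this
    simpa [h4] using h3
  have hsecond : ∀ t ∈ J, L (κ₀ t • N₀ t) = κ₀ (σ t) • N₀ (σ t) := fun t ht => by
    have h1 := (hddσ t ht).smul (HasDerivAt.scomp t (hasDerivAt_T₀ (σ t)) (hdσ t ht))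
    have h2 := (hLT t).unique (h1.congr_of_eventuallyEq (by
      filter_upwards [hnhds t ht] with r hr using hfirst r hr))
    rw [h2, hdd0 t ht, zero_smul, add_zero, smul_smul, ← sq, hsq t ht, one_smul]
  -- Norms in `hsecond` give κ(σ t) = κ(t), and κ is strictly decreasing for t ≥ 0. This also
  -- excludes reversing the arc.
  have hσid : ∀ t ∈ J, σ t = t := fun t ht => by
    have h1 := congrArg (fun v => ‖v‖) (hsecond t ht)
    simp only [L.norm_map, norm_smul, frenetCurve_c₀.norm_N, Real.norm_eq_abs, mul_one,
      abs_of_pos (frenetCurve_c₀.κ_pos _)] at h1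
    have h2 : 0 ≤ t := by linarith [ht.1]
    have h3 : 0 ≤ σ t := by linarith [(hσI t (hJI ht)).1]
    rcases lt_trichotomy (σ t) t with h4 | h4 | h4
    · linarith [κ₀_lt_κ₀ h3 h4]
    · exact h4
    · linarith [κ₀_lt_κ₀ h2 h4]
  have hfix : ∀ t ∈ J, L (T₀ t) = T₀ t := fun t ht => by
    refine (hMc t).unique ((hasDerivAt_c₀ t).congr_of_eventuallyEq ?_)
    filter_upwards [hnhds t ht] with r hr
    rw [hσ r (hJI hr), hσid r hr]
  -- Up to a scalar factor T₀ is a quadratic polynomial in t with independent coefficients. Since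
  -- `L` fixes T₀ t at three parameters, it fixes the coefficients; the numbers below invert the
  -- Vandermonde system at 1/5, 2/5, 3/5.
  have hT : ∀ t, (1 + t ^ 2) • T₀ t = EuclideanSpace.single 0 (1 : ℝ) +
      t • (√2 • EuclideanSpace.single 1 (1 : ℝ)) + t ^ 2 • EuclideanSpace.single 2 (1 : ℝ) := by
    intro t
    have := (one_add_sq_pos t).ne'
    apply ext_E3 <;> simp [T₀] <;> field_simp
  have hspan : ∀ x : E3, x = x 0 • EuclideanSpace.single 0 (1 : ℝ) +
      (x 1 / √2) • (√2 • EuclideanSpace.single 1 (1 : ℝ)) +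
      x 2 • EuclideanSpace.single 2 (1 : ℝ) := fun x => by apply ext_E3 <;> simp
  generalize (EuclideanSpace.single 0 (1 : ℝ) : E3) = e₀ at hT hspan
  generalize √2 • (EuclideanSpace.single 1 (1 : ℝ) : E3) = e₁ at hT hspan
  generalize (EuclideanSpace.single 2 (1 : ℝ) : E3) = e₂ at hT hspan
  have hpoly : ∀ t ∈ J, (L e₀ - e₀) + t • (L e₁ - e₁) + t ^ 2 • (L e₂ - e₂) = 0 := fun t ht => by
    have h1 : L ((1 + t ^ 2) • T₀ t) = (1 + t ^ 2) • T₀ t := by rw [map_smul, hfix t ht]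
    rw [hT, map_add, map_add, map_smul, map_smul, ← sub_eq_zero] at h1
    rw [← h1]
    module
  have p1 := hpoly (1 / 5) (by constructor <;> norm_num)
  have p2 := hpoly (2 / 5) (by constructor <;> norm_num)
  have p3 := hpoly (3 / 5) (by constructor <;> norm_num)
  have v0 : L e₀ = e₀ := by linear_combination (norm := module) (3 : ℝ) • p1 - (3 : ℝ) • p2 + p3
  have v2 : L e₂ = e₂ := by
    linear_combination (norm := module) (25 / 2 : ℝ) • p1 - (25 : ℝ) • p2 + (25 / 2 : ℝ) • p3
  have v1 : L e₁ = e₁ := by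
    linear_combination (norm := module) (-25 / 2 : ℝ) • p1 + (20 : ℝ) • p2 - (15 / 2 : ℝ) • p3
  have hL : ∀ x, L x = x := fun x => by
    rw [hspan x, map_add, map_add, map_smul, map_smul, map_smul, v0, v1, v2]
  have hhalf : (1 / 2 : ℝ) ∈ J := by constructor <;> norm_num
  have hd : d = 0 := by
    have h1 := hσ _ (hJI hhalf)
    rw [hσid _ hhalf, hM, hL] at h1
    simpa using h1
  intro x
  rw [hM, hL, hd, add_zero]

/-! ### The four curved foldings along `c₀` -/

/-- The oriented angle, measured in the Frenet frame of `c₀` at `c₀ u`, of the half plane `v > 0`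
of each of the four foldings. -/
noncomputable def creaseAngle : Fin 4 → ℝ → ℝ :=
  ![α₀, -α₀, fun u => -inverseAngle (1 / 10) (9 / 10) c₀ α₀ (-u + 1 / 10 + 9 / 10),
    fun u => inverseAngle (1 / 10) (9 / 10) c₀ α₀ (-u + 1 / 10 + 9 / 10)]

theorem isAngle_angleOf (i : Fin 4) :
    IsAngle (1 / 10) (9 / 10) (angleOf (1 / 10) (9 / 10) c₀ α₀ i) := by
  fin_cases i
  · exact isAngle_α₀
  · exact isAngle_α₀.neg
  · exact isAngle_inverseAngle
  · exact isAngle_inverseAngle.neg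

/-- Frenet frames of the four creases, compared with that of `c₀`. -/
theorem exists_frenetCurve_curveOf (i : Fin 4) : ∃ (T N B : ℝ → E3) (κ τ : ℝ → ℝ),
    FrenetCurve (curveOf (1 / 10) (9 / 10) c₀ i) T N B κ τ ∧
    (∀ t ∈ I₀, κ t * Real.cos (angleOf (1 / 10) (9 / 10) c₀ α₀ i t) = μ₀ t) ∧
    ∃ m : ℝ, (m = 1 ∨ m = -1) ∧ ∀ u ∈ I₀, ∃ t ∈ I₀,
      curveOf (1 / 10) (9 / 10) c₀ i t = c₀ u ∧ N t = N₀ u ∧ B t = m • B₀ u ∧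
      Real.cos (angleOf (1 / 10) (9 / 10) c₀ α₀ i t) = Real.cos (creaseAngle i u) ∧
      Real.sin (angleOf (1 / 10) (9 / 10) c₀ α₀ i t) = m * Real.sin (creaseAngle i u) := by
  have hflip : ∀ u : ℝ, -(-u + 1 / 10 + 9 / 10) + 1 / 10 + 9 / 10 = u := fun u => by ring
  have hinv : ∀ t ∈ I₀, κ₀ (-t + 1 / 10 + 9 / 10) *
      Real.cos (inverseAngle (1 / 10) (9 / 10) c₀ α₀ t) = μ₀ t := fun t ht => by
    rw [cos_inverseAngle ht, mul_div_cancel₀ _ (frenetCurve_c₀.κ_pos _).ne']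
  fin_cases i
  · exact ⟨_, _, _, _, _, frenetCurve_c₀, fun t _ => (μ₀_eq t).symm, 1, Or.inl rfl,
      fun u hu => ⟨u, hu, rfl, rfl, (one_smul _ _).symm, rfl, (one_mul _).symm⟩⟩
  · refine ⟨_, _, _, _, _, frenetCurve_c₀, fun t _ => ?_, 1, Or.inl rfl,
      fun u hu => ⟨u, hu, rfl, rfl, (one_smul _ _).symm, rfl, (one_mul _).symm⟩⟩
    rw [μ₀_eq, ← Real.cos_neg (α₀ t)]
    rfl
  -- The reversed curve meets c₀(u) at the parameter 1 - u.
  · refine ⟨_, _, _, _, _, frenetCurve_c₀.reversed _ _, hinv, -1, Or.inr rfl,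
      fun u hu => ⟨-u + 1 / 10 + 9 / 10, flip_mem hu, ?_, ?_, ?_, ?_, ?_⟩⟩
    · exact congrArg c₀ (hflip u)
    · simp only [hflip]
    · simp only [hflip, neg_one_smul]
    · exact (Real.cos_neg _).symm
    · simp [angleOf, creaseAngle]
  · refine ⟨_, _, _, _, _, frenetCurve_c₀.reversed _ _, fun t ht => ?_, -1, Or.inr rfl,
      fun u hu => ⟨-u + 1 / 10 + 9 / 10, flip_mem hu, ?_, ?_, ?_, ?_, ?_⟩⟩
    · rw [← hinv t ht, ← Real.cos_neg (inverseAngle _ _ _ _ t)]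
      rfl
    · exact congrArg c₀ (hflip u)
    · simp only [hflip]
    · simp only [hflip, neg_one_smul]
    · exact Real.cos_neg _
    · simp [angleOf, creaseAngle]

theorem exists_eq_curveOf (j : Fin 4) {s : ℝ} (hs : s ∈ I₀) :
    ∃ r ∈ I₀, curveOf (1 / 10) (9 / 10) c₀ j s = c₀ r := by
  fin_cases j
  · exact ⟨s, hs, rfl⟩
  · exact ⟨s, hs, rfl⟩
  · exact ⟨_, flip_mem hs, rfl⟩
  · exact ⟨_, flip_mem hs, rfl⟩

/-- The four foldings have different tangent half planes at `c₀ (1 / 4)`. -/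
theorem eq_of_creaseAngle_eq {i j : Fin 4}
    (hc : Real.cos (creaseAngle i (1 / 4)) = Real.cos (creaseAngle j (1 / 4)))
    (hs : Real.sin (creaseAngle i (1 / 4)) = Real.sin (creaseAngle j (1 / 4))) : i = j := by
  have h1 : (1 / 4 : ℝ) ∈ I₀ := by constructor <;> norm_num
  have h2 : (-(1 / 4) + 1 / 10 + 9 / 10 : ℝ) ∈ I₀ := flip_mem h1
  have hπ := Real.pi_pos
  have hs1 : 0 < Real.sin (α₀ (1 / 4)) := Real.sin_pos_of_pos_of_lt_pi
    (by linarith [pi_div_three_lt_α₀ h1]) (by linarith [α₀_lt h1])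
  have hs2 : 0 < Real.sin (inverseAngle (1 / 10) (9 / 10) c₀ α₀ (-(1 / 4) + 1 / 10 + 9 / 10)) :=
    Real.sin_pos_of_pos_of_lt_pi (inverseAngle_pos h2) (by linarith [inverseAngle_lt h2])
  -- Multiplied by κ(1/4), the two cosines become μ(1/4) and μ(3/4). At the midpoint u = 1/2 they
  -- would coincide.
  have hcc : Real.cos (α₀ (1 / 4)) ≠
      Real.cos (inverseAngle (1 / 10) (9 / 10) c₀ α₀ (-(1 / 4) + 1 / 10 + 9 / 10)) := by
    intro h
    have hκ := frenetCurve_c₀.κ_pos (1 / 4)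
    rw [cos_inverseAngle h2, eq_div_iff (frenetCurve_c₀.κ_pos _).ne',
      show -(-(1 / 4) + 1 / 10 + 9 / 10) + 1 / 10 + 9 / 10 = (1 / 4 : ℝ) by norm_num, mul_comm,
      ← μ₀_eq] at h
    exact (μ₀_lt_μ₀ h1 h2 (by norm_num)).ne' h
  set A := inverseAngle (1 / 10) (9 / 10) c₀ α₀ (-(1 / 4) + 1 / 10 + 9 / 10)
  have e0 : creaseAngle 0 (1 / 4) = α₀ (1 / 4) := rfl
  have e1 : creaseAngle 1 (1 / 4) = -α₀ (1 / 4) := rfl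
  have e2 : creaseAngle 2 (1 / 4) = -A := rfl
  have e3 : creaseAngle 3 (1 / 4) = A := rfl
  -- Opposite angles are told apart by the sign of the sine, all other pairs by the cosine.
  fin_cases i <;> fin_cases j <;> first
    | rfl
    | (exfalso
       simp only [Fin.zero_eta, Fin.mk_one, Fin.reduceFinMk, e0, e1, e2, e3, Real.cos_neg,
        Real.sin_neg] at hc hs
       first
        | linarith
        | exact hcc hc
        | exact hcc hc.symm)

end CurvedFolding

/-! ### Assembly of the theorem -/

theorem theoremB :
    -- the crease is an embedded unit speed curve with the stated curvature and torsion
    (ContDiff ℝ ∞ c₀ ∧ Set.InjOn c₀ I₀ ∧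
      ∀ t ∈ I₀, ‖deriv c₀ t‖ = 1 ∧ curvature c₀ t = √2 / (1 + t ^ 2) ∧
        torsion c₀ t = √2 / (1 + t ^ 2)) ∧
    -- there is an embedded unit speed plane curve, the crease pattern, with curvature `μ₀`
    (∃ γ : ℝ → E2, ContDiff ℝ ∞ γ ∧ Set.InjOn γ I₀ ∧
      ∀ t ∈ I₀, ‖deriv γ t‖ = 1 ∧ planeCurvature γ t = μ₀ t) ∧
    (∀ s ∈ I₀, ∀ t ∈ I₀, 0 < μ₀ s ∧ μ₀ s < curvature c₀ t) ∧
    ∃ ε₀ : ℝ, 0 < ε₀ ∧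
      -- the four strips are developable, and all have the same crease pattern
      (∀ i : Fin 4,
        IsDevelopableStrip (1 / 10) (9 / 10) ε₀ (curveOf (1 / 10) (9 / 10) c₀ i)
          (angleOf (1 / 10) (9 / 10) c₀ α₀ i)
          (strip (curveOf (1 / 10) (9 / 10) c₀ i) (angleOf (1 / 10) (9 / 10) c₀ α₀ i)) ∧
        ∀ t ∈ I₀, geodesicCurvature
          (strip (curveOf (1 / 10) (9 / 10) c₀ i) (angleOf (1 / 10) (9 / 10) c₀ α₀ i)) t
            = μ₀ t) ∧
      ∀ ε : ℝ, 0 < ε → ε ≤ ε₀ →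
        -- the four curved foldings are pairwise non-congruent
        (∀ i j : Fin 4, i ≠ j → ∀ T : E3 ≃ᵢ E3,
          T '' folding (1 / 10) (9 / 10) c₀ α₀ i ε ≠ folding (1 / 10) (9 / 10) c₀ α₀ j ε) ∧
        -- no piece of one of them is congruent to a subset of another
        ∀ δ : ℝ, 0 < δ → δ ≤ ε → ∀ i j : Fin 4, ∀ T : E3 ≃ᵢ E3,
          T '' folding (1 / 10) (9 / 10) c₀ α₀ i δ ⊆ folding (1 / 10) (9 / 10) c₀ α₀ j ε →
            i = j := by
  have hab : (1 / 10 : ℝ) < 9 / 10 := by norm_num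
  have hchart : ∀ i : Fin 4, ∃ ε > 0, IsFoldChart (1 / 10) (9 / 10) ε
      (spread (curveOf (1 / 10) (9 / 10) c₀ i) (angleOf (1 / 10) (9 / 10) c₀ α₀ i)) := by
    intro i
    obtain ⟨T, N, B, κ, τ, F, -⟩ := exists_frenetCurve_curveOf i
    refine F.exists_isFoldChart_spread (isAngle_angleOf i) (Function.Injective.injOn ?_)
    have hrev : Function.Injective (reversed (1 / 10) (9 / 10) c₀) := fun s t h => by
      have := injective_c₀ h
      linarith
    fin_cases i
    · exact injective_c₀
    · exact injective_c₀
    · exact hrev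
    · exact hrev
  choose ε' hε' hΨ' using hchart
  obtain ⟨ε₀, hε₀, hle⟩ : ∃ ε₀ > 0, ∀ i, ε₀ ≤ ε' i :=
    ⟨Finset.univ.inf' Finset.univ_nonempty ε', (Finset.lt_inf'_iff _).2 fun i _ => hε' i,
      fun i => Finset.inf'_le _ (Finset.mem_univ i)⟩
  have hΨ := fun i => (hΨ' i).mono (hle i)
  have main : ∀ ε : ℝ, 0 < ε → ε ≤ ε₀ → ∀ δ : ℝ, 0 < δ → δ ≤ ε → ∀ i j : Fin 4,
      ∀ T : E3 ≃ᵢ E3, T '' folding (1 / 10) (9 / 10) c₀ α₀ i δ ⊆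
        folding (1 / 10) (9 / 10) c₀ α₀ j ε → i = j := by
    intro ε _ hε δ hδ _ i j M hsub
    obtain ⟨T, N, B, κ, τ, F, -, m, hm, hF⟩ := exists_frenetCurve_curveOf i
    obtain ⟨T', N', B', κ', τ', F', -, m', hm', hF'⟩ := exists_frenetCurve_curveOf j
    have hchart := (hΨ j).mono hε
    obtain ⟨L, d, hM⟩ := exists_linear M
    have hcrease : ∀ u ∈ I₀, ∃ s ∈ I₀, M (c₀ u) = c₀ s := by
      intro u hu
      obtain ⟨t, ht, htu, -⟩ := hF u hu
      obtain ⟨s, hs, hst⟩ := exists_crease_eq F (isAngle_angleOf i) hab hδ hchart hM hsub ht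
      rw [htu] at hst
      obtain ⟨r, hr, hrs⟩ := exists_eq_curveOf j hs
      exact ⟨r, hr, hst.trans hrs⟩
    have hid := eq_id_of_mapsTo_crease hM hcrease
    have hsub' : foldImage (1 / 10) (9 / 10) (curveOf (1 / 10) (9 / 10) c₀ i)
        (angleOf (1 / 10) (9 / 10) c₀ α₀ i) δ ⊆ foldImage (1 / 10) (9 / 10)
        (curveOf (1 / 10) (9 / 10) c₀ j) (angleOf (1 / 10) (9 / 10) c₀ α₀ j) ε := by
      -- The isometry is the identity, so the hypothesis is a plain inclusion.
      intro x hx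
      have := hsub (Set.mem_image_of_mem M hx)
      rwa [hid x] at this
    have hu : (1 / 4 : ℝ) ∈ I₀ := by constructor <;> norm_num
    obtain ⟨t, ht, htc, htN, htB, htcos, htsin⟩ := hF _ hu
    obtain ⟨s, hs, hsc, hsN, hsB, hscos, hssin⟩ := hF' _ hu
    have hmm : m * m = 1 := by rcases hm with rfl | rfl <;> norm_num
    have hmm' : m' * m' = 1 := by rcases hm' with rfl | rfl <;> norm_num
    have hk : m' * m = 1 ∨ m' * m = -1 := by
      rcases hm with rfl | rfl <;> rcases hm' with rfl | rfl <;> norm_num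
    obtain ⟨h1, h2⟩ := angle_eq_of_subset F F' (isAngle_angleOf j) hδ hchart hsub' hs
      (isAngle_angleOf i) ht (htc.trans hsc.symm) (hsN.trans htN.symm) hk
      (by rw [hsB, htB, smul_smul, mul_assoc, hmm, mul_one])
    refine eq_of_creaseAngle_eq (htcos.symm.trans (h1.trans hscos)) ?_
    rw [htsin, hssin] at h2
    -- The orientation signs `m` and `m'` square to 1 and cancel.
    linear_combination m * h2 +
      (Real.sin (creaseAngle j (1 / 4)) - Real.sin (creaseAngle i (1 / 4))) * hmm +
      Real.sin (creaseAngle j (1 / 4)) * m * m * hmm'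
  refine ⟨⟨contDiff_c₀, injective_c₀.injOn, fun t _ => ⟨?_, ?_, ?_⟩⟩, ?_, ?_, ε₀, hε₀, ?_, ?_⟩
  · rw [frenetCurve_c₀.deriv_eq, frenetCurve_c₀.norm_T]
  · rw [frenetCurve_c₀.curvature_eq]; rfl
  · rw [frenetCurve_c₀.torsion_eq]; rfl
  · obtain ⟨γ, h1, h2, h3⟩ := exists_creasePattern
    exact ⟨γ, h1, h2, fun t _ => h3 t⟩
  · intro s hs t ht
    rw [frenetCurve_c₀.curvature_eq]
    exact ⟨μ₀_pos hs, μ₀_lt_κ₀ hs ht⟩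
  · intro i
    obtain ⟨T, N, B, κ, τ, F, hμ, -⟩ := exists_frenetCurve_curveOf i
    refine ⟨F.isDevelopableStrip (isAngle_angleOf i) (hΨ i), fun t ht => ?_⟩
    rw [F.geodesicCurvature_strip, hμ t ht]
  -- Congruence is the case δ = ε of the nested statement.
  · exact fun ε hε hεle => ⟨fun i j hij M h => hij (main ε hε hεle ε hε le_rfl i j M h.subset),
      main ε hε hεle⟩
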